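/- Let $\mathbb{F}_q$ be a finite field of characteristic different from $2$ and $3$, and let $E$ be the elliptic curve $y^2=f(x)$, $f(x)=x^3+Ax+B$, where $A,B\in\mathbb{F}_q$ and $f$ has no multiple roots. Let $\varphi$ be the Frobenius endomorphism $(x,y)\mapsto(x^q,y^q)$ of $E(\mathbb{F}_{q^3})$ and let $T_3=\{P\in E(\mathbb{F}_{q^3}) : P+\varphi(P)+\varphi^2(P)=P_\infty\}$. For $P\in T_3\setminus\{P_\infty\}$ let $h_P=y-(\alpha_1x+\alpha_0)$, with $\alpha_1,\alpha_0\in\mathbb{F}_q$, be the equation of the line through $P,\varphi(P),\varphi^2(P)$ (counted with multiplicity, i.e. $\mathrm{div}(h_P)=P+\varphi(P)+\varphi^2(P)-3P_\infty$). Note that $h_{-P}(x,y)=-h_P(x,-y)$. Define the following polynomials in $\alpha_1,\alpha_0,A,B$. Doubling formulas, $h_{2P}=cy-(u_0+u_1x)$: $u_1 = 4B\alpha_1^4 - 4A\alpha_1^3\alpha_0 + 4A^2\alpha_1^2 - 4\alpha_1\alpha_0^3 + 36B\alpha_1\alpha_0 - 12A\alpha_0^2$, $u_0 = -A^2\alpha_1^4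 - 8B\alpha_1^3\alpha_0 + 2A\alpha_1^2\alpha_0^2 + 6AB\alpha_1^2 - 8A^2\alpha_1\alpha_0 - \alpha_0^4 - 18B\alpha_0^2 + 4A^3 + 27B^2$, $c = 8B\alpha_1^3 - 8A\alpha_1^2\alpha_0 - 8\alpha_0^3$. Tripling formulas, $h_{3P}=dy-(v_0+v_1x)$: $v_1 = \tfrac{1}{3}A^4\alpha_1^9 + 8A^2B\alpha_1^8\alpha_0 + (-4A^3 + 48B^2)\alpha_1^7\alpha_0^2 + (16A^3B + 144B^3)\alpha_1^7 - 48AB\alpha_1^6\alpha_0^3 + (-16A^4 - 240AB^2)\alpha_1^6\alpha_0 + 10A^2\alpha_1^5\alpha_0^4 + 192A^2B\alpha_1^5\alpha_0^2 + (8A^5 + 54A^2B^2)\alpha_1^5 - 24B\alpha_1^4\alpha_0^5 + (-112A^3 + 144B^2)\alpha_1^4\alpha_0^3 + (96A^3B + 648B^3)\alpha_1^4\alpha_0 + 12A\alpha_1^3\alpha_0^6 - 240AB\alpha_1^3\alpha_0^4 + (-48A^4 - 324AB^2)\alpha_1^3\alpha_0^2 + (-32A^4B - 216AB^3)\alpha_1^3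 - 48A^2\alpha_1^2\alpha_0^5 + (64A^5 + 432A^2B^2)\alpha_1^2\alpha_0 + 3\alpha_1\alpha_0^8 - 288B\alpha_1\alpha_0^6 + (-24A^3 - 162B^2)\alpha_1\alpha_0^4 + (288A^3B + 1944B^3)\alpha_1\alpha_0^2 + (-16A^6 - 216A^3B^2 - 729B^4)\alpha_1 + 48A\alpha_0^7 + (-64A^4 - 432AB^2)\alpha_0^3$, $v_0 = (-\tfrac{8}{3}A^3B - \tfrac{64}{3}B^3)\alpha_1^9 + (3A^4 + 32AB^2)\alpha_1^8\alpha_0 - 16A^2B\alpha_1^7\alpha_0^2 - 8A^2B^2\alpha_1^7 + (12A^3 + 16B^2)\alpha_1^6\alpha_0^3 + (8A^3B - 144B^3)\alpha_1^6\alpha_0 + 8AB\alpha_1^5\alpha_0^4 + 288AB^2\alpha_1^5\alpha_0^2 + (32A^4B + 216AB^3)\alpha_1^5 + 10A^2\alpha_1^4\alpha_0^5 - 200A^2B\alpha_1^4\alpha_0^3 + (-24A^5 - 162A^2B^2)\alpha_1^4\alpha_0 + 32B\alpha_1^3\alpha_0^6 + (64A^3 + 72B^2)\alpha_1^3\alpha_0^4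 + (192A^3B + 1296B^3)\alpha_1^3\alpha_0^2 + (96A^3B^2 + 648B^4)\alpha_1^3 - 4A\alpha_1^2\alpha_0^7 - 72AB\alpha_1^2\alpha_0^5 + (-176A^4 - 1188AB^2)\alpha_1^2\alpha_0^3 + (-192A^4B - 1296AB^3)\alpha_1^2\alpha_0 + 64A^2\alpha_1\alpha_0^6 + (128A^5 + 864A^2B^2)\alpha_1\alpha_0^2 + \tfrac{1}{3}\alpha_0^9 + 72B\alpha_0^7 + (-120A^3 - 810B^2)\alpha_0^5 + (192A^3B + 1296B^3)\alpha_0^3 + (-16A^6 - 216A^3B^2 - 729B^4)\alpha_0$, $d = A^4\alpha_1^8 + 24A^2B\alpha_1^7\alpha_0 + (-12A^3 + 144B^2)\alpha_1^6\alpha_0^2 + (-24A^3B - 144B^3)\alpha_1^6 - 144AB\alpha_1^5\alpha_0^3 + (32A^4 + 144AB^2)\alpha_1^5\alpha_0 + 30A^2\alpha_1^4\alpha_0^4 + 120A^2B\alpha_1^4\alpha_0^2 + (-8A^5 - 54A^2B^2)\alpha_1^4 - 72B\alpha_1^3\alpha_0^5 + 720B^2\alpha_1^3\alpha_0^3 +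 (-96A^3B - 648B^3)\alpha_1^3\alpha_0 + 36A\alpha_1^2\alpha_0^6 - 360AB\alpha_1^2\alpha_0^4 + (48A^4 + 324AB^2)\alpha_1^2\alpha_0^2 + 96A^2\alpha_1\alpha_0^5 + 9\alpha_0^8 + 72B\alpha_0^6 + (24A^3 + 162B^2)\alpha_0^4 - \tfrac{16}{3}A^6 - 72A^3B^2 - 243B^4$. Procedure 2, run on $y-(\alpha_1x+\alpha_0)$ with $\alpha_1,\alpha_0$ in a field $k\supseteq\mathbb{F}_q$, is the following computation, with variables $x_{P_i},y_{P_i}$ ($i=1,2,3$). 1. Put $x_{2P_i}=\left(\frac{f'(x_{P_i})}{2y_{P_i}}\right)^2-2x_{P_i}$, $y_{2P_i}=\frac{f'(x_{P_i})}{2y_{P_i}}(x_{P_i}-x_{2P_i})-y_{P_i}$ and $\ell_i=(y_{2P_i}-y_{P_i})x+(x_{P_i}-x_{2P_i})y+\left((x_{2P_i}-x_{P_i})y_{P_i}+(y_{P_i}-y_{2P_i})x_{P_i}\right)$ (the line through $P_i$ and $2P_i$), and $L=\ell_1\ell_2\ell_3$. 2. Replace each $y_{P_i}$ in $L$ by $\alpha_1x_{P_i}+\alpha_0$,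 and write $L$ as a polynomial in $x,y$ whose coefficients are rational functions, over $k$, of the elementary symmetric polynomials $e_1,e_2,e_3$ of $x_{P_1},x_{P_2},x_{P_3}$. 3. Replace $e_1,e_2,e_3$ by $E_1=\alpha_1^2$, $E_2=A-2\alpha_0\alpha_1$, $E_3=\alpha_0^2-B$ in $L$. This gives $L(x,y)\in k[x,y]$. 4. Return $\dfrac{L(x,-y)}{h_{-P}\,h_{-2P}} \bmod y^2-f(x)$, computed in the field of fractions of $k[x,y]/(y^2-f(x))$, where $h_{-P}=y+(\alpha_1x+\alpha_0)$ and $h_{-2P}=cy+(u_0+u_1x)$. **Theorem.** Procedure 2 is correct. Precisely: (a) For every field $k\supseteq\mathbb{F}_q$ and all $\alpha_1,\alpha_0\in k$ with $c\neq0$ (in particular for $k=\mathbb{F}_q(\alpha_1,\alpha_0)$ with $\alpha_1,\alpha_0$ indeterminates) steps 2 and 3 can be carried out (with denominators that do not vanish under the substitution), their result $L(x,y)$ is unique, and step 4 returns, up to multiplication by a nonzero constant of $k$, the class of $dy-(v_0+v_1x)$. (b) For every $P\in T_3\setminus\{P_\infty\}$ the line $h_P=y-(\alpha_1x+\alpha_0)$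 exists and is unique. If $3P\neq P_\infty$, then $d\ne0$ and $h_{3P}=dy-(v_0+v_1x)$ up to multiplication by a nonzero constant, that is, $h_{3P}=y-\left(\frac{v_1}{d}x+\frac{v_0}{d}\right)$. If moreover $2P\neq P_\infty$, then $c\neq0$, so that Procedure 2 can be run on $h_P$, and it returns the class of $h_{3P}$ up to multiplication by a nonzero constant of $\mathbb{F}_q$. -/

import Mathlib

open Polynomial
open scoped Polynomial.Bivariate

universe u v

noncomputable section

namespace TraceZero

/-! ## The curve, the trace-zero subgroup and the line through the Frobenius conjugates -/

/-- The short Weierstrass curve `y² = x³ + A x + B`. -/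
def curve {k : Type*} [CommRing k] (A B : k) : WeierstrassCurve.Affine k :=
  { a₁ := 0, a₂ := 0, a₃ := 0, a₄ := A, a₆ := B }

/-- The cubic `f = x³ + A x + B`. -/
def cubic {k : Type*} [CommRing k] (A B : k) : k[X] :=
  X ^ 3 + C A * X + C B

section Points

variable {F : Type*} [Field F] (K : Type*) [Field K] [Algebra F K]

/-- The group `E(K)` for a field extension `K` of the field of definition of `E`. -/
abbrev Points (A B : F) : Type _ :=
  (WeierstrassCurve.Affine.baseChange (curve A B) K).Point

variable [Fintype F] [DecidableEq K]

/-- The Frobenius endomorphism `(x, y) ↦ (x ^ q, y ^ q)` of `E(K)`, where `q = |F|`. -/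
def frob (A B : F) : Points K A B →+ Points K A B :=
  WeierstrassCurve.Affine.Point.map (W' := curve A B) (FiniteField.frobeniusAlgHom F K)

/-- The degree three trace-zero subgroup: all `P` with `P + φ(P) + φ²(P) = 0`. -/
def T₃ (A B : F) : AddSubgroup (Points K A B) :=
  (AddMonoidHom.id _ + frob K A B + (frob K A B).comp (frob K A B)).ker

variable {K}

/-- `IsConjLine P α₁ α₀` says that `y - (α₁ x + α₀)` is the equation `h_P` of the line through
`P`, `φ(P)` and `φ²(P)`: these are affine points `(x i, y i)` on the line, and they are, counted
with multiplicity, all the intersection points of the line with the curve (substituting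
`y = α₁ x + α₀` in `f - y²` leaves the product of the `X - x i`). In other words the divisor of
`y - (α₁ x + α₀)` on `E` is `P + φ(P) + φ²(P) - 3 P_∞`. -/
def IsConjLine {A B : F} (P : Points K A B) (α₁ α₀ : F) : Prop :=
  ∃ (x y : Fin 3 → K)
    (h : ∀ i, (WeierstrassCurve.Affine.baseChange (curve A B) K).Nonsingular (x i) (y i)),
    (∀ i : Fin 3, (frob K A B)^[(i : ℕ)] P = .some (x i) (y i) (h i)) ∧
    (∀ i, y i = algebraMap F K α₁ * x i + algebraMap F K α₀) ∧
    (cubic A B - (C α₁ * X + C α₀) ^ 2).map (algebraMap F K) = ∏ i, (X - C (x i))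

end Points

/-! ## The explicit doubling and tripling formulas -/

section Formulas

variable {k : Type*} [Field k]

/-- Doubling formulas `h_{2P} = c y - (u₀ + u₁ x)`: the coefficient `u₁`. -/
def u₁ (A B α₁ α₀ : k) : k :=
  4 * B * α₁^4 - 4 * A * α₁^3 * α₀ + 4 * A^2 * α₁^2 - 4 * α₁ * α₀^3 + 36 * B * α₁ * α₀ - 12 * A
    * α₀^2

/-- Doubling formulas `h_{2P} = c y - (u₀ + u₁ x)`: the coefficient `u₀`. -/
def u₀ (A B α₁ α₀ : k) : k :=
  -A^2 * α₁^4 - 8 * B * α₁^3 * α₀ + 2 * A * α₁^2 * α₀^2 + 6 * A * B * α₁^2 - 8 * A^2 * α₁ * α₀ -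
    α₀^4 - 18 * B * α₀^2 + 4 * A^3 + 27 * B^2

/-- Doubling formulas `h_{2P} = c y - (u₀ + u₁ x)`: the coefficient `c`. -/
def c (A B α₁ α₀ : k) : k :=
  8 * B * α₁^3 - 8 * A * α₁^2 * α₀ - 8 * α₀^3

/-- Tripling formulas `h_{3P} = d y - (v₀ + v₁ x)`: the coefficient `v₁`. -/
def v₁ (A B α₁ α₀ : k) : k :=
  1/3 * A^4 * α₁^9 + 8 * A^2 * B * α₁^8 * α₀ + (-4 * A^3 + 48 * B^2) * α₁^7 * α₀^2 + (16 * A^3 *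
    B + 144 * B^3) * α₁^7 - 48 * A * B * α₁^6 * α₀^3 + (-16 * A^4 - 240 * A * B^2) * α₁^6 * α₀ +
    10 * A^2 * α₁^5 * α₀^4 + 192 * A^2 * B * α₁^5 * α₀^2 + (8 * A^5 + 54 * A^2 * B^2) * α₁^5 -
    24 * B * α₁^4 * α₀^5 + (-112 * A^3 + 144 * B^2) * α₁^4 * α₀^3 + (96 * A^3 * B + 648 * B^3) *
    α₁^4 * α₀ + 12 * A * α₁^3 * α₀^6 - 240 * A * B * α₁^3 * α₀^4 + (-48 * A^4 - 324 * A * B^2) *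
    α₁^3 * α₀^2 + (-32 * A^4 * B - 216 * A * B^3) * α₁^3 - 48 * A^2 * α₁^2 * α₀^5 + (64 * A^5 +
    432 * A^2 * B^2) * α₁^2 * α₀ + 3 * α₁ * α₀^8 - 288 * B * α₁ * α₀^6 + (-24 * A^3 - 162 * B^2)
    * α₁ * α₀^4 + (288 * A^3 * B + 1944 * B^3) * α₁ * α₀^2 + (-16 * A^6 - 216 * A^3 * B^2 - 729
    * B^4) * α₁ + 48 * A * α₀^7 + (-64 * A^4 - 432 * A * B^2) * α₀^3

/-- Tripling formulas `h_{3P} = d y - (v₀ + v₁ x)`: the coefficient `v₀`. -/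
def v₀ (A B α₁ α₀ : k) : k :=
  (-8/3 * A^3 * B - 64/3 * B^3) * α₁^9 + (3 * A^4 + 32 * A * B^2) * α₁^8 * α₀ - 16 * A^2 * B *
    α₁^7 * α₀^2 - 8 * A^2 * B^2 * α₁^7 + (12 * A^3 + 16 * B^2) * α₁^6 * α₀^3 + (8 * A^3 * B -
    144 * B^3) * α₁^6 * α₀ + 8 * A * B * α₁^5 * α₀^4 + 288 * A * B^2 * α₁^5 * α₀^2 + (32 * A^4 *
    B + 216 * A * B^3) * α₁^5 + 10 * A^2 * α₁^4 * α₀^5 - 200 * A^2 * B * α₁^4 * α₀^3 + (-24 *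
    A^5 - 162 * A^2 * B^2) * α₁^4 * α₀ + 32 * B * α₁^3 * α₀^6 + (64 * A^3 + 72 * B^2) * α₁^3 *
    α₀^4 + (192 * A^3 * B + 1296 * B^3) * α₁^3 * α₀^2 + (96 * A^3 * B^2 + 648 * B^4) * α₁^3 - 4
    * A * α₁^2 * α₀^7 - 72 * A * B * α₁^2 * α₀^5 + (-176 * A^4 - 1188 * A * B^2) * α₁^2 * α₀^3 +
    (-192 * A^4 * B - 1296 * A * B^3) * α₁^2 * α₀ + 64 * A^2 * α₁ * α₀^6 + (128 * A^5 + 864 *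
    A^2 * B^2) * α₁ * α₀^2 + 1/3 * α₀^9 + 72 * B * α₀^7 + (-120 * A^3 - 810 * B^2) * α₀^5 + (192
    * A^3 * B + 1296 * B^3) * α₀^3 + (-16 * A^6 - 216 * A^3 * B^2 - 729 * B^4) * α₀

/-- Tripling formulas `h_{3P} = d y - (v₀ + v₁ x)`: the coefficient `d`. -/
def d (A B α₁ α₀ : k) : k :=
  A^4 * α₁^8 + 24 * A^2 * B * α₁^7 * α₀ + (-12 * A^3 + 144 * B^2) * α₁^6 * α₀^2 + (-24 * A^3 * B
    - 144 * B^3) * α₁^6 - 144 * A * B * α₁^5 * α₀^3 + (32 * A^4 + 144 * A * B^2) * α₁^5 * α₀ +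
    30 * A^2 * α₁^4 * α₀^4 + 120 * A^2 * B * α₁^4 * α₀^2 + (-8 * A^5 - 54 * A^2 * B^2) * α₁^4 -
    72 * B * α₁^3 * α₀^5 + 720 * B^2 * α₁^3 * α₀^3 + (-96 * A^3 * B - 648 * B^3) * α₁^3 * α₀ +
    36 * A * α₁^2 * α₀^6 - 360 * A * B * α₁^2 * α₀^4 + (48 * A^4 + 324 * A * B^2) * α₁^2 * α₀^2
    + 96 * A^2 * α₁ * α₀^5 + 9 * α₀^8 + 72 * B * α₀^6 + (24 * A^3 + 162 * B^2) * α₀^4 - 16/3 *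
    A^6 - 72 * A^3 * B^2 - 243 * B^4

/-- The polynomial `γ y - (β₁ x + β₀)` in `k[x, y]`; here `C X` is `x` and `Y` is `y`. -/
def linePoly (γ β₁ β₀ : k) : k[X][Y] :=
  C (C γ) * Y - C (C β₁ * X + C β₀)

/-- The substitution `g(x, y) ↦ g(x, -y)`. -/
def flipY (g : k[X][Y]) : k[X][Y] := g.comp (-Polynomial.X)

end Formulas

/-! ## Procedure 2 -/

section Procedure

/-- The `x`-coordinate of `2P` as a rational expression in the coordinates of `P = (x, y)`. -/
def dblX {M : Type*} [Field M] (A x y : M) : M :=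
  ((3 * x ^ 2 + A) / (2 * y)) ^ 2 - 2 * x

/-- The `y`-coordinate of `2P` as a rational expression in the coordinates of `P = (x, y)`. -/
def dblY {M : Type*} [Field M] (A x y : M) : M :=
  (3 * x ^ 2 + A) / (2 * y) * (x - dblX A x y) - y

/-- The line `ℓ` through `P = (x₁, y₁)` and `2P = (x₂, y₂)`:
`(y₂ - y₁) x + (x₁ - x₂) y + ((x₂ - x₁) y₁ + (y₁ - y₂) x₁)`. -/
def ell {M : Type*} [Field M] (A x₁ y₁ : M) : M[X][Y] :=
  let x₂ := dblX A x₁ y₁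
  let y₂ := dblY A x₁ y₁
  C (C (y₂ - y₁) * X) + C (C (x₁ - x₂)) * Y + C (C ((x₂ - x₁) * y₁ + (y₁ - y₂) * x₁))

variable {k : Type*} [Field k]

/-- Rational functions over `k` in the three variables `x_{P₁}, x_{P₂}, x_{P₃}`. -/
abbrev RatFun₃ (k : Type*) [Field k] : Type _ := FractionRing (MvPolynomial (Fin 3) k)

/-- The product `L = ℓ₁ ℓ₂ ℓ₃`, after replacing `y_{Pᵢ}` by `α₁ x_{Pᵢ} + α₀`. It is a polynomial
in `x, y` whose coefficients are rational functions of `x_{P₁}, x_{P₂}, x_{P₃}`. -/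
def prodL (A α₁ α₀ : k) : (RatFun₃ k)[X][Y] :=
  ∏ i : Fin 3,
    ell (algebraMap k (RatFun₃ k) A)
      (algebraMap (MvPolynomial (Fin 3) k) (RatFun₃ k) (MvPolynomial.X i))
      (algebraMap (MvPolynomial (Fin 3) k) (RatFun₃ k)
        (MvPolynomial.C α₁ * MvPolynomial.X i + MvPolynomial.C α₀))

/-- A polynomial `N(e₁, e₂, e₃)` read as a function of `x_{P₁}, x_{P₂}, x_{P₃}`, where `eᵢ` is the
`i`-th elementary symmetric polynomial in these variables. -/
def inEsymm : MvPolynomial (Fin 3) k →+* RatFun₃ k :=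
  (algebraMap (MvPolynomial (Fin 3) k) (RatFun₃ k)).comp
    (MvPolynomial.aeval fun i : Fin 3 => MvPolynomial.esymm (Fin 3) k (i + 1)).toRingHom

/-- `IsSymmSubst E L L'`: one can write `L = N(e₁, e₂, e₃) / D(e₁, e₂, e₃)`, with `N` a polynomial
in `x, y` whose coefficients are polynomials in `e₁, e₂, e₃`, and with `D(E₁, E₂, E₃) ≠ 0`, and
replacing `eᵢ` by `Eᵢ` in this expression gives `L'`. -/
def IsSymmSubst (E : Fin 3 → k) (L : (RatFun₃ k)[X][Y]) (L' : k[X][Y]) : Prop :=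
  ∃ (N : (MvPolynomial (Fin 3) k)[X][Y]) (D : MvPolynomial (Fin 3) k),
    MvPolynomial.eval E D ≠ 0 ∧
    L = C (C (inEsymm D)⁻¹) * N.map (mapRingHom inEsymm) ∧
    L' = C (C (MvPolynomial.eval E D)⁻¹) * N.map (mapRingHom (MvPolynomial.eval E))

/-- `IsProcL A B α₁ α₀ L'`: the polynomial `L' ∈ k[x, y]` is obtained from `h_P = y - (α₁ x + α₀)`
by the steps of the procedure that precede the division: form the product of the lines through
`Pᵢ` and `2Pᵢ`, replace `y_{Pᵢ}` by `α₁ x_{Pᵢ} + α₀`, write the result in `e₁, e₂, e₃`, and replace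
`e₁, e₂, e₃` by `E₁ = α₁²`, `E₂ = A - 2 α₀ α₁`, `E₃ = α₀² - B`. -/
def IsProcL (A B α₁ α₀ : k) (L' : k[X][Y]) : Prop :=
  IsSymmSubst ![α₁ ^ 2, A - 2 * α₀ * α₁, α₀ ^ 2 - B] (prodL A α₁ α₀) L'

/-- The class of a polynomial in `x, y` modulo `y² - f(x)`, in the function field of `E`. -/
def toFun (A B : k) (g : k[X][Y]) : (curve A B).FunctionField :=
  algebraMap (curve A B).CoordinateRing (curve A B).FunctionField
    (WeierstrassCurve.Affine.CoordinateRing.mk (curve A B) g)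

/-- The last step of the procedure: `L'(x, -y) / (h_{-P} h_{-2P})` modulo `y² - f(x)`, where
`h_{-Q}(x, y) = -h_Q(x, -y)` and `h_{2P} = c y - (u₀ + u₁ x)` is given by the doubling formulas. -/
def recovered (A B α₁ α₀ : k) (L' : k[X][Y]) : (curve A B).FunctionField :=
  toFun A B (flipY L') /
    (toFun A B (-flipY (linePoly 1 α₁ α₀)) *
      toFun A B (-flipY (linePoly (c A B α₁ α₀) (u₁ A B α₁ α₀) (u₀ A B α₁ α₀))))

end Procedure

end TraceZero

end

/-!
Over a splitting field of `f - (α₁ x + α₀)²`, the product over its three roots `xᵢ` of the tangent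
lines at `Pᵢ = (xᵢ, α₁ xᵢ + α₀)`, or of the lines through `Pᵢ` and `2 Pᵢ`, is a norm from the cubic
algebra `k[r] / (f(r) - (α₁ r + α₀)²)`, hence a polynomial in `α₁, α₀, A, B, x, y`. Modulo
`y² = f(x)` the first norm is `h_P² h_{-2P}` and the second is `h_P h_{2P} h_{-3P}`, up to
constants, where `h_{2P}` and `h_{3P}` are given by the doubling and tripling formulas. The second
identity is the correctness of the procedure. Read as identities of fractional ideals of the
coordinate ring, the two identities say that the formulas have the divisors of `h_{2P}` and
`h_{3P}`. A line is determined up to a scalar by its divisor; in particular the line through the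
Frobenius conjugates of a point is fixed by Frobenius, so its coefficients lie in the base field.
-/

universe w

noncomputable section

namespace TraceZero

section CubicNorm

variable {R : Type*} [CommRing R]

/-- The elementary symmetric functions of the roots: `esymm₃ r i` has degree `i + 1`. -/
def esymm₃ (r : Fin 3 → R) : Fin 3 → R :=
  ![r 0 + r 1 + r 2, r 0 * r 1 + r 0 * r 2 + r 1 * r 2, r 0 * r 1 * r 2]

/-- The norm of `p₀ + p₁ r + p₂ r²` from the cubic algebra `R[r] / (r³ - e₀ r² + e₁ r - e₂)`. -/
def cubicNorm (e p : Fin 3 → R) : R :=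
  p 0 ^ 3 + e 0 * p 0 ^ 2 * p 1 + (e 0 ^ 2 - 2 * e 1) * p 0 ^ 2 * p 2 + e 1 * p 0 * p 1 ^ 2 +
    (e 0 * e 1 - 3 * e 2) * p 0 * p 1 * p 2 + (e 1 ^ 2 - 2 * e 0 * e 2) * p 0 * p 2 ^ 2 +
    e 2 * p 1 ^ 3 + e 0 * e 2 * p 1 ^ 2 * p 2 + e 1 * e 2 * p 1 * p 2 ^ 2 + e 2 ^ 2 * p 2 ^ 3

/-- The derivative of the norm at `p` in the direction `q`: the part of `cubicNorm e (p + q)`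
that is quadratic in `p` and linear in `q`. -/
def cubicNormDeriv (e p q : Fin 3 → R) : R :=
  q 0 * (3 * p 0 ^ 2 + 2 * e 0 * p 0 * p 1 + 2 * (e 0 ^ 2 - 2 * e 1) * p 0 * p 2 +
      e 1 * p 1 ^ 2 + (e 0 * e 1 - 3 * e 2) * p 1 * p 2 + (e 1 ^ 2 - 2 * e 0 * e 2) * p 2 ^ 2) +
    q 1 * (e 0 * p 0 ^ 2 + 2 * e 1 * p 0 * p 1 + (e 0 * e 1 - 3 * e 2) * p 0 * p 2 +
      3 * e 2 * p 1 ^ 2 + 2 * e 0 * e 2 * p 1 * p 2 + e 1 * e 2 * p 2 ^ 2) +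
    q 2 * ((e 0 ^ 2 - 2 * e 1) * p 0 ^ 2 + (e 0 * e 1 - 3 * e 2) * p 0 * p 1 +
      2 * (e 1 ^ 2 - 2 * e 0 * e 2) * p 0 * p 2 + e 0 * e 2 * p 1 ^ 2 +
      2 * e 1 * e 2 * p 1 * p 2 + 3 * e 2 ^ 2 * p 2 ^ 2)

/-- The coordinates of `r (p₀ + p₁ r + p₂ r²)` in `R[r] / (r³ - e₀ r² + e₁ r - e₂)`. -/
def mulRoot (e p : Fin 3 → R) : Fin 3 → R :=
  ![e 2 * p 2, p 0 - e 1 * p 2, p 1 + e 0 * p 2]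

lemma esymm₃_comp {S : Type*} [CommRing S] (φ : R →+* S) (r : Fin 3 → R) :
    esymm₃ (φ ∘ r) = φ ∘ esymm₃ r := by
  funext i
  fin_cases i <;> simp [esymm₃]

lemma prod_sub_eq_esymm₃ (r : Fin 3 → R) (x : R) :
    ∏ i, (x - r i) = x ^ 3 - esymm₃ r 0 * x ^ 2 + esymm₃ r 1 * x - esymm₃ r 2 := by
  simp only [Fin.prod_univ_three, esymm₃, Matrix.cons_val]
  ring

lemma pow_three_eq_esymm₃ (r : Fin 3 → R) (i : Fin 3) :
    r i ^ 3 = esymm₃ r 0 * r i ^ 2 - esymm₃ r 1 * r i + esymm₃ r 2 := by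
  have h := prod_sub_eq_esymm₃ r (r i)
  rw [Finset.prod_eq_zero (Finset.mem_univ i) (sub_self _)] at h
  linear_combination -h

lemma prod_eq_cubicNorm (r p : Fin 3 → R) :
    ∏ i, (p 0 + p 1 * r i + p 2 * r i ^ 2) = cubicNorm (esymm₃ r) p := by
  simp only [Fin.prod_univ_three, cubicNorm, esymm₃, Matrix.cons_val]
  ring

/- `x ^ 3 - e₀ x ^ 2 + e₁ x - e₂` is `(x - r)` times `x ^ 2 + (r - e₀) x + ((r - e₀) r + e₁)`, and
the coefficient of `h` is the derivative of the norm at `S` in the direction of the product of `T`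
with the second factor. -/
lemma cubicNorm_pencil (e S T : Fin 3 → R) (x h : R) :
    cubicNorm e (x • S - mulRoot e S + h • T) =
      cubicNorm e S * (x ^ 3 - e 0 * x ^ 2 + e 1 * x - e 2) +
        h * (x ^ 2 * cubicNormDeriv e S T + x * cubicNormDeriv e S (mulRoot e T - e 0 • T) +
          cubicNormDeriv e S (mulRoot e (mulRoot e T - e 0 • T) + e 1 • T)) +
        h ^ 2 * (x * cubicNormDeriv e T S - cubicNormDeriv e T (mulRoot e S)) +
        h ^ 3 * cubicNorm e T := by
  simp only [cubicNorm, cubicNormDeriv, mulRoot, Pi.add_apply, Pi.sub_apply, Pi.smul_apply,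
    smul_eq_mul, Matrix.cons_val]
  ring

lemma prod_pencil (r S T : Fin 3 → R) (x h : R) :
    ∏ i, ((S 0 + S 1 * r i + S 2 * r i ^ 2) * (x - r i) +
        (T 0 + T 1 * r i + T 2 * r i ^ 2) * h) =
      cubicNorm (esymm₃ r) (x • S - mulRoot (esymm₃ r) S + h • T) := by
  rw [← prod_eq_cubicNorm]
  refine Finset.prod_congr rfl fun i _ ↦ ?_
  simp only [mulRoot, Pi.add_apply, Pi.sub_apply, Pi.smul_apply, smul_eq_mul, Matrix.cons_val]
  linear_combination -S 2 * pow_three_eq_esymm₃ r i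

end CubicNorm

section LineSection

variable {R : Type*} [CommRing R]

/-- The elementary symmetric functions of the abscissae of the three points in which the line
`y = α₁ x + α₀` meets the curve `y² = x³ + A x + B`. -/
def lineEsymm (A B α₁ α₀ : R) : Fin 3 → R :=
  ![α₁ ^ 2, A - 2 * α₀ * α₁, α₀ ^ 2 - B]

lemma lineEsymm_map {S : Type*} [CommRing S] (φ : R →+* S) (A B α₁ α₀ : R) :
    lineEsymm (φ A) (φ B) (φ α₁) (φ α₀) = φ ∘ lineEsymm A B α₁ α₀ := by
  funext i
  fin_cases i <;> simp [lineEsymm, map_ofNat]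

lemma lineEsymm_cubic_eq {A B x y : R} (hxy : y ^ 2 = x ^ 3 + A * x + B) (α₁ α₀ : R) :
    x ^ 3 - lineEsymm A B α₁ α₀ 0 * x ^ 2 + lineEsymm A B α₁ α₀ 1 * x - lineEsymm A B α₁ α₀ 2 =
      (y - (α₁ * x + α₀)) * (y + (α₁ * x + α₀)) := by
  simp only [lineEsymm, Matrix.cons_val]
  linear_combination -hxy

/-- The tangent at `P = (x₁, y₁)`, with denominators cleared. -/
def tangentForm (A x₁ y₁ x y : R) : R :=
  (3 * x₁ ^ 2 + A) * (x - x₁) - 2 * y₁ * (y - y₁)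

/-- The numerator `12 x y² - (3 x² + A)²` of `x(P) - x(2P)`; it is the third division polynomial
on the curve. -/
def psiNum (A x y : R) : R := 12 * x * y ^ 2 - (3 * x ^ 2 + A) ^ 2

/-- The numerator of `y(2P) - y(P)`. -/
def slopeNum (A x y : R) : R := (3 * x ^ 2 + A) * psiNum A x y - 16 * y ^ 4

lemma slopeNum_of_two_mul_eq_zero {A x y : R} (hy : 2 * y = 0) :
    slopeNum A x y = -(3 * x ^ 2 + A) ^ 3 := by
  rw [slopeNum, psiNum]
  linear_combination (6 * x * y * (3 * x ^ 2 + A) - 8 * y ^ 3) * hy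

lemma slopeNum_of_psiNum_eq_zero {A x y : R} (hψ : psiNum A x y = 0) :
    slopeNum A x y = -(2 * y) ^ 4 := by
  rw [slopeNum, hψ]
  ring

/-- The line through `P = (x₁, y₁)` and `2P`, with denominators cleared. -/
def lineForm (A x₁ y₁ x y : R) : R :=
  slopeNum A x₁ y₁ * (x - x₁) + 2 * y₁ * psiNum A x₁ y₁ * (y - y₁)

/-- The coordinates of `slopeNum + 2 α₁ y psiNum`, for `y = α₁ r + α₀`, in the cubic algebra of
the line `y = α₁ x + α₀`. -/
def slopeCoeff (A B α₁ α₀ : R) : Fin 3 → R :=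
  ![-α₁^6 * α₀^2 + α₁^6 * B - 10 * α₁^3 * α₀^3 + 10 * α₁^3 * α₀ * B + 9 * α₁^2 * α₀^2 * A - 9 *
    α₁^2 * A * B - 2 * α₁ * α₀ * A^2 - 7 * α₀^4 + 18 * α₀^2 * B - A^3 - 27 * B^2,
    -2 * α₁^7 * α₀ + α₁^6 * A - 21 * α₁^4 * α₀^2 + α₁^4 * B + 28 * α₁^3 * α₀ * A - 11 * α₁^2 *
    A^2 - 22 * α₁ * α₀^3 + 54 * α₁ * α₀ * B + 3 * α₀^2 * A - 27 * A * B,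
    -α₁^8 - 12 * α₁^5 * α₀ + 10 * α₁^4 * A - 24 * α₁^2 * α₀^2 + 36 * α₁^2 * B + 12 * α₁ * α₀ * A
    - 9 * A^2]

/-- The coordinates of `2 y psiNum`, for `y = α₁ r + α₀`, in the cubic algebra of the line
`y = α₁ x + α₀`. -/
def vertCoeff (A B α₁ α₀ : R) : Fin 3 → R :=
  ![6 * α₁^5 * α₀^2 - 6 * α₁^5 * B + 18 * α₁^2 * α₀^3 - 18 * α₁^2 * α₀ * B + 6 * α₁ * α₀^2 * A -
    6 * α₁ * A * B - 2 * α₀ * A^2,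
    12 * α₁^6 * α₀ - 6 * α₁^5 * A + 42 * α₁^3 * α₀^2 - 6 * α₁^3 * B - 6 * α₁^2 * α₀ * A - 8 * α₁
    * A^2 + 6 * α₀^3 + 18 * α₀ * B,
    6 * α₁^7 + 30 * α₁^4 * α₀ + 18 * α₁ * α₀^2 + 18 * α₁ * B + 6 * α₀ * A]

lemma lineForm_eq_pencil {A B α₁ α₀ : R} {r : Fin 3 → R}
    (hr : esymm₃ r = lineEsymm A B α₁ α₀) (i : Fin 3) (x y : R) :
    lineForm A (r i) (α₁ * r i + α₀) x y =
      (slopeCoeff A B α₁ α₀ 0 + slopeCoeff A B α₁ α₀ 1 * r i + slopeCoeff A B α₁ α₀ 2 * r i ^ 2) *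
          (x - r i) +
        (vertCoeff A B α₁ α₀ 0 + vertCoeff A B α₁ α₀ 1 * r i + vertCoeff A B α₁ α₀ 2 * r i ^ 2) *
          (y - (α₁ * x + α₀)) := by
  have hcubic := pow_three_eq_esymm₃ r i
  rw [hr] at hcubic
  generalize r i = r at hcubic ⊢
  have hslope : slopeNum A r (α₁ * r + α₀) + α₁ * (2 * (α₁ * r + α₀) * psiNum A r (α₁ * r + α₀)) =
      slopeCoeff A B α₁ α₀ 0 + slopeCoeff A B α₁ α₀ 1 * r + slopeCoeff A B α₁ α₀ 2 * r ^ 2 := by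
    simp only [slopeNum, psiNum, slopeCoeff, lineEsymm, Matrix.cons_val] at hcubic ⊢
    linear_combination
      (-α₁^6 - α₁^4 * r - 10 * α₁^3 * α₀ + 9 * α₁^2 * A - 9 * α₁^2 * r^2 + 9 * α₀^2 + 27 * B -
      27 * r^3) * hcubic
  have hvert : 2 * (α₁ * r + α₀) * psiNum A r (α₁ * r + α₀) =
      vertCoeff A B α₁ α₀ 0 + vertCoeff A B α₁ α₀ 1 * r + vertCoeff A B α₁ α₀ 2 * r ^ 2 := by
    simp only [psiNum, vertCoeff, lineEsymm, Matrix.cons_val] at hcubic ⊢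
    linear_combination
      (6 * α₁^5 + 6 * α₁^3 * r + 18 * α₁^2 * α₀ + 6 * α₁ * A - 18 * α₁ * r^2 - 18 * α₀ * r) *
        hcubic
  rw [← hslope, ← hvert, lineForm]
  ring

end LineSection

section Formulas

variable {k : Type*} [Field k] (A B α₁ α₀ : k)

lemma c_neg : c A B (-α₁) (-α₀) = -c A B α₁ α₀ := by
  rw [c, c]
  ring

lemma u₁_neg : u₁ A B (-α₁) (-α₀) = u₁ A B α₁ α₀ := by
  rw [u₁, u₁]
  ring

lemma u₀_neg : u₀ A B (-α₁) (-α₀) = u₀ A B α₁ α₀ := by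
  rw [u₀, u₀]
  ring

lemma d_neg : d A B (-α₁) (-α₀) = d A B α₁ α₀ := by
  rw [d, d]
  ring

lemma v₁_neg : v₁ A B (-α₁) (-α₀) = -v₁ A B α₁ α₀ := by
  rw [v₁, v₁]
  ring

lemma v₀_neg : v₀ A B (-α₁) (-α₀) = -v₀ A B α₁ α₀ := by
  rw [v₀, v₀]
  ring

variable {K : Type*} [Field K] (ι : k →+* K)

lemma map_c : ι (c A B α₁ α₀) = c (ι A) (ι B) (ι α₁) (ι α₀) := by
  simp [c, map_ofNat]

lemma map_u₁ : ι (u₁ A B α₁ α₀) = u₁ (ι A) (ι B) (ι α₁) (ι α₀) := by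
  simp [u₁, map_ofNat]

lemma map_u₀ : ι (u₀ A B α₁ α₀) = u₀ (ι A) (ι B) (ι α₁) (ι α₀) := by
  simp [u₀, map_ofNat]

lemma map_d : ι (d A B α₁ α₀) = d (ι A) (ι B) (ι α₁) (ι α₀) := by
  simp [d, map_ofNat]

lemma map_v₁ : ι (v₁ A B α₁ α₀) = v₁ (ι A) (ι B) (ι α₁) (ι α₀) := by
  simp [v₁, map_ofNat]

lemma map_v₀ : ι (v₀ A B α₁ α₀) = v₀ (ι A) (ι B) (ι α₁) (ι α₀) := by
  simp [v₀, map_ofNat]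

end Formulas

section LineProducts

variable {k : Type*} [Field k] {A B α₁ α₀ x y : k} {r : Fin 3 → k}

lemma prod_ordinate_eq (hr : esymm₃ r = lineEsymm A B α₁ α₀) :
    ∏ i, (2 * (α₁ * r i + α₀)) = -c A B α₁ α₀ := by
  have h := prod_eq_cubicNorm r ![2 * α₀, 2 * α₁, 0]
  rw [hr] at h
  simp only [cubicNorm, lineEsymm, Matrix.cons_val] at h
  rw [Finset.prod_congr rfl fun i _ ↦ show 2 * (α₁ * r i + α₀) =
    2 * α₀ + 2 * α₁ * r i + 0 * r i ^ 2 by ring, h, c]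
  ring

/-- `h_P²` times the flipped line `-h_{2P}(x, -y)` is the product of the three tangents. -/
lemma prod_tangentForm (hr : esymm₃ r = lineEsymm A B α₁ α₀) (hxy : y ^ 2 = x ^ 3 + A * x + B) :
    ∏ i, tangentForm A (r i) (α₁ * r i + α₀) x y =
      (y - (α₁ * x + α₀)) ^ 2 * (c A B α₁ α₀ * y + (u₁ A B α₁ α₀ * x + u₀ A B α₁ α₀)) := by
  have h := prod_pencil r ![A - 2 * α₁ * α₀, -2 * α₁ ^ 2, 3] ![-2 * α₀, -2 * α₁, 0] x
    (y - (α₁ * x + α₀))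
  rw [hr, cubicNorm_pencil, lineEsymm_cubic_eq hxy] at h
  simp only [Matrix.cons_val] at h
  convert h using 1
  · refine Finset.prod_congr rfl fun i _ ↦ ?_
    rw [tangentForm]
    ring
  · simp only [cubicNorm, cubicNormDeriv, mulRoot, lineEsymm, Pi.add_apply, Pi.sub_apply,
      Pi.smul_apply, smul_eq_mul, Matrix.cons_val, c, u₁, u₀]
    ring

variable (A B α₁ α₀)

lemma cubicNorm_vertCoeff (h3 : (3 : k) ≠ 0) :
    cubicNorm (lineEsymm A B α₁ α₀) (vertCoeff A B α₁ α₀) =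
      -(3 * (c A B α₁ α₀ * d A B α₁ α₀)) := by
  simp only [cubicNorm, lineEsymm, Matrix.cons_val, vertCoeff, c, d]
  field_simp
  ring

lemma cubicNormDeriv_vertCoeff_slopeCoeff (h3 : (3 : k) ≠ 0) :
    cubicNormDeriv (lineEsymm A B α₁ α₀) (vertCoeff A B α₁ α₀) (slopeCoeff A B α₁ α₀) =
      -(3 * (c A B α₁ α₀ * (d A B α₁ α₀ * α₁ + v₁ A B α₁ α₀) +
        d A B α₁ α₀ * (c A B α₁ α₀ * α₁ - u₁ A B α₁ α₀))) := by
  simp only [cubicNormDeriv, lineEsymm, Matrix.cons_val, slopeCoeff, vertCoeff, c, d, v₁, u₁]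
  field_simp
  ring

lemma cubicNormDeriv_slopeCoeff_vertCoeff (h3 : (3 : k) ≠ 0) :
    cubicNormDeriv (lineEsymm A B α₁ α₀) (slopeCoeff A B α₁ α₀) (vertCoeff A B α₁ α₀) =
      -(3 * ((c A B α₁ α₀ * α₁ - u₁ A B α₁ α₀) * (d A B α₁ α₀ * α₁ + v₁ A B α₁ α₀))) := by
  simp only [cubicNormDeriv, lineEsymm, Matrix.cons_val, slopeCoeff, vertCoeff, c, d, v₁, u₁]
  field_simp
  ring

lemma cubicNorm_slopeCoeff_sub (h3 : (3 : k) ≠ 0) :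
    cubicNorm (lineEsymm A B α₁ α₀) (slopeCoeff A B α₁ α₀) -
        cubicNormDeriv (lineEsymm A B α₁ α₀) (vertCoeff A B α₁ α₀)
          (mulRoot (lineEsymm A B α₁ α₀) (slopeCoeff A B α₁ α₀)) =
      -(3 * (c A B α₁ α₀ * (d A B α₁ α₀ * α₀ + v₀ A B α₁ α₀) +
        d A B α₁ α₀ * (c A B α₁ α₀ * α₀ - u₀ A B α₁ α₀))) := by
  simp only [cubicNorm, cubicNormDeriv, mulRoot, lineEsymm, Matrix.cons_val, slopeCoeff, vertCoeff,
    c, d, v₀, u₀]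
  field_simp
  ring

lemma two_mul_α₁_mul_cubicNorm_slopeCoeff_add (h3 : (3 : k) ≠ 0) :
    2 * α₁ * cubicNorm (lineEsymm A B α₁ α₀) (slopeCoeff A B α₁ α₀) +
        cubicNormDeriv (lineEsymm A B α₁ α₀) (slopeCoeff A B α₁ α₀)
          (mulRoot (lineEsymm A B α₁ α₀) (vertCoeff A B α₁ α₀) -
            lineEsymm A B α₁ α₀ 0 • vertCoeff A B α₁ α₀) =
      -(3 * ((c A B α₁ α₀ * α₁ - u₁ A B α₁ α₀) * (d A B α₁ α₀ * α₀ + v₀ A B α₁ α₀) +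
        (c A B α₁ α₀ * α₀ - u₀ A B α₁ α₀) * (d A B α₁ α₀ * α₁ + v₁ A B α₁ α₀))) := by
  simp only [cubicNorm, cubicNormDeriv, mulRoot, lineEsymm, Pi.smul_apply, Pi.sub_apply,
    smul_eq_mul, Matrix.cons_val, slopeCoeff, vertCoeff, c, d, v₁, v₀, u₁, u₀]
  field_simp
  ring

lemma two_mul_α₀_mul_cubicNorm_slopeCoeff_add (h3 : (3 : k) ≠ 0) :
    2 * α₀ * cubicNorm (lineEsymm A B α₁ α₀) (slopeCoeff A B α₁ α₀) +
        cubicNormDeriv (lineEsymm A B α₁ α₀) (slopeCoeff A B α₁ α₀)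
          (mulRoot (lineEsymm A B α₁ α₀) (mulRoot (lineEsymm A B α₁ α₀) (vertCoeff A B α₁ α₀) -
            lineEsymm A B α₁ α₀ 0 • vertCoeff A B α₁ α₀) +
            lineEsymm A B α₁ α₀ 1 • vertCoeff A B α₁ α₀) =
      -(3 * ((c A B α₁ α₀ * α₀ - u₀ A B α₁ α₀) * (d A B α₁ α₀ * α₀ + v₀ A B α₁ α₀))) := by
  simp only [cubicNorm, cubicNormDeriv, mulRoot, lineEsymm, Pi.add_apply, Pi.smul_apply,
    Pi.sub_apply, smul_eq_mul, Matrix.cons_val, slopeCoeff, vertCoeff, c, d, v₀, u₀]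
  field_simp
  ring

variable {A B α₁ α₀}

/-- `h_P h_{2P}` times the flipped line `-h_{3P}(x, -y)` is, up to a constant, the product of the
three lines through `Pᵢ` and `2Pᵢ`. -/
lemma prod_lineForm (h3 : (3 : k) ≠ 0) (hr : esymm₃ r = lineEsymm A B α₁ α₀)
    (hxy : y ^ 2 = x ^ 3 + A * x + B) :
    ∏ i, lineForm A (r i) (α₁ * r i + α₀) x y =
      -(3 * (y - (α₁ * x + α₀)) * (c A B α₁ α₀ * y - (u₁ A B α₁ α₀ * x + u₀ A B α₁ α₀)) *
        (d A B α₁ α₀ * y + (v₁ A B α₁ α₀ * x + v₀ A B α₁ α₀))) := by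
  rw [Finset.prod_congr rfl fun i _ ↦ lineForm_eq_pencil hr i x y, prod_pencil, hr,
    cubicNorm_pencil, lineEsymm_cubic_eq hxy]
  obtain ⟨h, rfl⟩ : ∃ h, y = h + (α₁ * x + α₀) := ⟨y - (α₁ * x + α₀), by ring⟩
  linear_combination h ^ 3 * cubicNorm_vertCoeff A B α₁ α₀ h3 +
    h ^ 2 * x * cubicNormDeriv_vertCoeff_slopeCoeff A B α₁ α₀ h3 +
    h ^ 2 * cubicNorm_slopeCoeff_sub A B α₁ α₀ h3 +
    h * x ^ 2 * cubicNormDeriv_slopeCoeff_vertCoeff A B α₁ α₀ h3 +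
    h * x * two_mul_α₁_mul_cubicNorm_slopeCoeff_add A B α₁ α₀ h3 +
    h * two_mul_α₀_mul_cubicNorm_slopeCoeff_add A B α₁ α₀ h3

end LineProducts

section SymmSubst

open MvPolynomial (esymm eval₂Hom)

variable {k : Type*} [Field k]

/-- The substitution of the elementary symmetric polynomials for the three variables. -/
def esymmSubst : MvPolynomial (Fin 3) k →+* MvPolynomial (Fin 3) k :=
  (MvPolynomial.aeval fun i : Fin 3 ↦ esymm (Fin 3) k (i + 1)).toRingHom

lemma inEsymm_eq_comp_esymmSubst :
    inEsymm (k := k) = (algebraMap (MvPolynomial (Fin 3) k) (RatFun₃ k)).comp esymmSubst :=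
  rfl

lemma exists_esymmSubst_eq {p : MvPolynomial (Fin 3) k} (hp : p.IsSymmetric) :
    ∃ q, esymmSubst q = p := by
  obtain ⟨q, hq⟩ := MvPolynomial.esymmAlgHom_surjective (σ := Fin 3) (R := k) (n := 3) (by simp)
    ⟨p, hp⟩
  exact ⟨q, (MvPolynomial.esymmAlgHom_apply q).symm.trans (congrArg Subtype.val hq)⟩

lemma exists_map_esymmSubst_eq {T : (MvPolynomial (Fin 3) k)[X][Y]}
    (hT : ∀ e : Equiv.Perm (Fin 3),
      T.map (mapRingHom (MvPolynomial.rename (R := k) e).toRingHom) = T) :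
    ∃ N : (MvPolynomial (Fin 3) k)[X][Y], N.map (mapRingHom esymmSubst) = T := by
  refine (mem_lifts _).mp ((lifts_iff_coeff_lifts T).mpr fun n ↦ ?_)
  refine (mem_lifts _).mp ((lifts_iff_coeff_lifts (T.coeff n)).mpr fun m ↦ ?_)
  refine exists_esymmSubst_eq fun e ↦ ?_
  conv_rhs => rw [← hT e]
  simp only [coeff_map, coe_mapRingHom, AlgHom.toRingHom_eq_coe, RingHom.coe_coe]

variable {K : Type*} [Field K] {ι : k →+* K}

lemma eval₂Hom_esymm (ι : k →+* K) (ρ : Fin 3 → K) (i : Fin 3) :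
    eval₂Hom ι ρ (esymm (Fin 3) k (i + 1)) = esymm₃ ρ i := by
  have h₁ : Finset.powersetCard 1 (Finset.univ : Finset (Fin 3)) = {{0}, {1}, {2}} := by decide
  have h₂ : Finset.powersetCard 2 (Finset.univ : Finset (Fin 3)) = {{0, 1}, {0, 2}, {1, 2}} := by
    decide
  have h₃ : Finset.powersetCard 3 (Finset.univ : Finset (Fin 3)) = {{0, 1, 2}} := by decide
  have hpair : ({0, 1} : Finset (Fin 3)) ∉ ({{0, 2}, {1, 2}} : Finset (Finset (Fin 3))) ∧
      ({0, 2} : Finset (Fin 3)) ≠ {1, 2} := by decide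
  fin_cases i <;> simp [esymm, esymm₃, h₁, h₂, h₃, hpair, Finset.sum_insert, add_assoc, mul_assoc]

variable {E : Fin 3 → k} {ρ : Fin 3 → K}

lemma eval₂Hom_comp_esymmSubst (hρ : esymm₃ ρ = ι ∘ E) :
    (eval₂Hom ι ρ).comp esymmSubst = ι.comp (MvPolynomial.eval E) := by
  refine MvPolynomial.ringHom_ext (fun a ↦ ?_) fun i ↦ ?_
  · simp [esymmSubst]
  · simpa [esymmSubst, ← eval₂Hom_esymm ι] using congrFun hρ i

lemma C_C_mul_C_C_inv_mul {a : K} (ha : a ≠ 0) (g : K[X][Y]) : C (C a) * (C (C a⁻¹) * g) = g := by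
  rw [← mul_assoc, ← C_mul, ← C_mul, mul_inv_cancel₀ ha, C_1, C_1, one_mul]

variable {L : (RatFun₃ k)[X][Y]} {T : (MvPolynomial (Fin 3) k)[X][Y]}
  {D : MvPolynomial (Fin 3) k}

lemma exists_isSymmSubst (hρ : esymm₃ ρ = ι ∘ E) (hDρ : eval₂Hom ι ρ D ≠ 0)
    (hL : L = C (C (algebraMap _ (RatFun₃ k) D)⁻¹) *
      T.map (mapRingHom (algebraMap _ (RatFun₃ k)))) (hD : D.IsSymmetric)
    (hT : ∀ e : Equiv.Perm (Fin 3),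
      T.map (mapRingHom (MvPolynomial.rename (R := k) e).toRingHom) = T) :
    ∃ L', IsSymmSubst E L L' := by
  obtain ⟨N, rfl⟩ := exists_map_esymmSubst_eq hT
  obtain ⟨D, rfl⟩ := exists_esymmSubst_eq hD
  have hDE : eval₂Hom ι ρ (esymmSubst D) = ι (MvPolynomial.eval E D) :=
    DFunLike.congr_fun (eval₂Hom_comp_esymmSubst hρ) D
  refine ⟨_, N, D, fun h ↦ hDρ (by rw [hDE, h, map_zero]), ?_, rfl⟩
  rw [hL, Polynomial.map_map, mapRingHom_comp, inEsymm_eq_comp_esymmSubst, RingHom.comp_apply]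

lemma IsSymmSubst.map_eq {L' : k[X][Y]} (h : IsSymmSubst E L L')
    (hρ : esymm₃ ρ = ι ∘ E) (hD : D ≠ 0)
    (hL : L = C (C (algebraMap _ (RatFun₃ k) D)⁻¹) *
      T.map (mapRingHom (algebraMap _ (RatFun₃ k)))) :
    C (C (eval₂Hom ι ρ D)) * L'.map (mapRingHom ι) =
      T.map (mapRingHom (eval₂Hom ι ρ)) := by
  obtain ⟨N, D', hD', hL', rfl⟩ := h
  have hinj := IsFractionRing.injective (MvPolynomial (Fin 3) k) (RatFun₃ k)
  have hDE : eval₂Hom ι ρ (esymmSubst D') = ι (MvPolynomial.eval E D') :=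
    DFunLike.congr_fun (eval₂Hom_comp_esymmSubst hρ) D'
  have hDE0 : ι (MvPolynomial.eval E D') ≠ 0 := (_root_.map_ne_zero _).mpr hD'
  have hD'0 : esymmSubst D' ≠ 0 := fun h ↦ hDE0 (by rw [← hDE, h, map_zero])
  have hN : C (C D) * N.map (mapRingHom esymmSubst) = C (C (esymmSubst D')) * T := by
    apply Polynomial.map_injective (mapRingHom (algebraMap _ (RatFun₃ k)))
      (Polynomial.map_injective _ hinj)
    simp only [Polynomial.map_mul, map_C, coe_mapRingHom, Polynomial.map_map, mapRingHom_comp]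
    rw [← C_C_mul_C_C_inv_mul ((map_ne_zero_iff _ hinj).mpr hD) (T.map _), ← hL, hL',
      mul_left_comm, inEsymm_eq_comp_esymmSubst, RingHom.comp_apply,
      C_C_mul_C_C_inv_mul ((map_ne_zero_iff _ hinj).mpr hD'0)]
  have hNρ := congrArg (Polynomial.map (mapRingHom (eval₂Hom ι ρ))) hN
  simp only [Polynomial.map_mul, map_C, coe_mapRingHom, Polynomial.map_map, mapRingHom_comp,
    eval₂Hom_comp_esymmSubst hρ, hDE] at hNρ
  simp only [Polynomial.map_mul, map_C, coe_mapRingHom, Polynomial.map_map, mapRingHom_comp,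
    map_inv₀]
  apply mul_left_cancel₀ (C_ne_zero.mpr (C_ne_zero.mpr hDE0))
  rw [mul_left_comm, C_C_mul_C_C_inv_mul hDE0, hNρ]

end SymmSubst

section LineProductPolynomial

/-- The form `lineForm` as a polynomial in the coordinates `x, y` of the plane. -/
def linePolyForm {R : Type*} [CommRing R] (A x₁ y₁ : R) : R[X][Y] :=
  lineForm (C (C A)) (C (C x₁)) (C (C y₁)) (C X) Y

lemma map_linePolyForm {R S : Type*} [CommRing R] [CommRing S] (φ : R →+* S) (A x₁ y₁ : R) :
    (linePolyForm A x₁ y₁).map (mapRingHom φ) = linePolyForm (φ A) (φ x₁) (φ y₁) := by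
  simp [linePolyForm, lineForm, slopeNum, psiNum]

lemma evalEval_linePolyForm {R : Type*} [CommRing R] (A x₁ y₁ x y : R) :
    (linePolyForm A x₁ y₁).evalEval x y = lineForm A x₁ y₁ x y := by
  simp [linePolyForm, lineForm, slopeNum, psiNum, evalEval]

lemma sub_dblX {M : Type*} [Field M] (h2 : (2 : M) ≠ 0) (A x : M) {y : M} (hy : y ≠ 0) :
    x - dblX A x y = ((2 * y) ^ 3)⁻¹ * (2 * y * psiNum A x y) := by
  simp only [dblX, psiNum]
  field_simp
  ring

lemma dblY_sub {M : Type*} [Field M] (h2 : (2 : M) ≠ 0) (A x : M) {y : M} (hy : y ≠ 0) :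
    dblY A x y - y = ((2 * y) ^ 3)⁻¹ * slopeNum A x y := by
  rw [dblY, sub_dblX h2 A x hy, slopeNum]
  field_simp
  ring

lemma ell_eq_linePolyForm {M : Type*} [Field M] (h2 : (2 : M) ≠ 0) (A x : M) {y : M}
    (hy : y ≠ 0) : ell A x y = C (C ((2 * y) ^ 3)⁻¹) * linePolyForm A x y := by
  have h : ell A x y = C (C (dblY A x y - y)) * (C X - C (C x)) +
      C (C (x - dblX A x y)) * (Y - C (C y)) := by
    simp only [ell, map_add, map_sub, map_mul]
    ring
  rw [h, sub_dblX h2 A x hy, dblY_sub h2 A x hy]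
  simp only [linePolyForm, lineForm, slopeNum, psiNum, map_mul, map_add, map_sub, map_pow,
    map_ofNat]
  ring

variable {k : Type*} [Field k]

/-- The numerator of `prodL`. -/
def prodLNum (A α₁ α₀ : k) : (MvPolynomial (Fin 3) k)[X][Y] :=
  ∏ i, linePolyForm (MvPolynomial.C A) (MvPolynomial.X i)
    (MvPolynomial.C α₁ * MvPolynomial.X i + MvPolynomial.C α₀)

/-- The denominator of `prodL`. -/
def prodLDen (α₁ α₀ : k) : MvPolynomial (Fin 3) k :=
  ∏ i, (2 * (MvPolynomial.C α₁ * MvPolynomial.X i + MvPolynomial.C α₀)) ^ 3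

lemma map_prodLNum {K : Type*} [Field K] (ι : k →+* K) (ρ : Fin 3 → K) (A α₁ α₀ : k) :
    (prodLNum A α₁ α₀).map (mapRingHom (MvPolynomial.eval₂Hom ι ρ)) =
      ∏ i, linePolyForm (ι A) (ρ i) (ι α₁ * ρ i + ι α₀) := by
  simp [prodLNum, Polynomial.map_prod, map_linePolyForm]

lemma eval₂Hom_prodLDen {K : Type*} [Field K] (ι : k →+* K) (ρ : Fin 3 → K) (α₁ α₀ : k) :
    MvPolynomial.eval₂Hom ι ρ (prodLDen α₁ α₀) =
      (∏ i, (2 * (ι α₁ * ρ i + ι α₀))) ^ 3 := by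
  simp only [prodLDen, map_prod, map_pow, map_mul, map_ofNat, map_add, MvPolynomial.eval₂Hom_C,
    MvPolynomial.eval₂Hom_X', Finset.prod_pow]

lemma prodLNum_symm (A α₁ α₀ : k) (e : Equiv.Perm (Fin 3)) :
    (prodLNum A α₁ α₀).map (mapRingHom (MvPolynomial.rename (R := k) e).toRingHom) =
      prodLNum A α₁ α₀ := by
  rw [prodLNum, Polynomial.map_prod]
  conv_rhs => rw [← Equiv.prod_comp e]
  refine Finset.prod_congr rfl fun i _ ↦ ?_
  rw [map_linePolyForm]
  simp

lemma prodLDen_symm (α₁ α₀ : k) : (prodLDen α₁ α₀).IsSymmetric := by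
  intro e
  rw [prodLDen, map_prod]
  conv_rhs => rw [← Equiv.prod_comp e]
  simp [map_ofNat]

lemma prodL_eq {α₁ α₀ : k} (hD : prodLDen α₁ α₀ ≠ 0) (A : k) :
    prodL A α₁ α₀ = C (C (algebraMap _ (RatFun₃ k) (prodLDen α₁ α₀))⁻¹) *
      (prodLNum A α₁ α₀).map (mapRingHom (algebraMap _ (RatFun₃ k))) := by
  set φ := algebraMap (MvPolynomial (Fin 3) k) (RatFun₃ k)
  have hφ : Function.Injective φ := IsFractionRing.injective _ _
  have hy (i : Fin 3) : 2 * (MvPolynomial.C α₁ * MvPolynomial.X i + MvPolynomial.C α₀) ≠ 0 :=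
    ne_zero_pow three_ne_zero (Finset.prod_ne_zero_iff.mp hD i (Finset.mem_univ i))
  have hφy (i : Fin 3) : 2 * φ (MvPolynomial.C α₁ * MvPolynomial.X i + MvPolynomial.C α₀) ≠ 0 := by
    rw [← map_ofNat φ 2, ← map_mul]
    exact (map_ne_zero_iff φ hφ).mpr (hy i)
  rw [prodL, prodLDen, prodLNum, Polynomial.map_prod, map_prod, ← Finset.prod_inv_distrib,
    map_prod, map_prod, ← Finset.prod_mul_distrib]
  refine Finset.prod_congr rfl fun i _ ↦ ?_
  rw [ell_eq_linePolyForm (left_ne_zero_of_mul (hφy i)) _ _ (right_ne_zero_of_mul (hφy i)),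
    map_linePolyForm, map_pow, map_mul φ, map_ofNat]
  rfl

end LineProductPolynomial

section Procedure

lemma exists_esymm₃_eq {K : Type*} [Field K] [IsAlgClosed K] (e : Fin 3 → K) :
    ∃ r : Fin 3 → K, esymm₃ r = e := by
  let P : Cubic K := ⟨1, -e 0, e 1, -e 2⟩
  obtain ⟨x, y, z, h⟩ := (Cubic.splits_iff_roots_eq_three (φ := RingHom.id K) (P := P)
    one_ne_zero).mp (IsAlgClosed.splits _)
  have hb := Cubic.b_eq_three_roots one_ne_zero h
  have hc := Cubic.c_eq_three_roots one_ne_zero h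
  have hd := Cubic.d_eq_three_roots one_ne_zero h
  simp only [P, RingHom.id_apply, one_mul, neg_inj] at hb hc hd
  refine ⟨![x, y, z], funext fun i ↦ ?_⟩
  fin_cases i
  exacts [hb.symm, hc.symm, hd.symm]

variable {k : Type*} [Field k] {A B α₁ α₀ : k}

variable {K : Type*} [Field K] {ι : k →+* K} {ρ : Fin 3 → K}

lemma eval₂Hom_prodLDen_eq_c (hρ : esymm₃ ρ = lineEsymm (ι A) (ι B) (ι α₁) (ι α₀)) :
    MvPolynomial.eval₂Hom ι ρ (prodLDen α₁ α₀) = ι (-c A B α₁ α₀ ^ 3) := by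
  rw [eval₂Hom_prodLDen, prod_ordinate_eq hρ, ← map_c, ← map_neg, ← map_pow,
    Odd.neg_pow (by decide)]

lemma prodLDen_ne_zero (hc : c A B α₁ α₀ ≠ 0) : prodLDen α₁ α₀ ≠ 0 := by
  obtain ⟨ρ, hρ⟩ := exists_esymm₃_eq (lineEsymm (algebraMap k (AlgebraicClosure k) A)
    (algebraMap k _ B) (algebraMap k _ α₁) (algebraMap k _ α₀))
  intro h
  have h0 := eval₂Hom_prodLDen_eq_c hρ
  rw [h, map_zero, eq_comm, map_eq_zero, neg_eq_zero] at h0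
  exact pow_ne_zero 3 hc h0

lemma IsProcL.map_eq (hc : c A B α₁ α₀ ≠ 0) {L : k[X][Y]} (hL : IsProcL A B α₁ α₀ L)
    (hρ : esymm₃ ρ = lineEsymm (ι A) (ι B) (ι α₁) (ι α₀)) :
    C (C (ι (-c A B α₁ α₀ ^ 3))) * L.map (mapRingHom ι) =
      ∏ i, linePolyForm (ι A) (ρ i) (ι α₁ * ρ i + ι α₀) := by
  have hD := prodLDen_ne_zero hc
  rw [← map_prodLNum, ← eval₂Hom_prodLDen_eq_c hρ]
  exact IsSymmSubst.map_eq hL (hρ.trans (lineEsymm_map ι A B α₁ α₀)) hD (prodL_eq hD A)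

lemma existsUnique_isProcL (hc : c A B α₁ α₀ ≠ 0) : ∃! L : k[X][Y], IsProcL A B α₁ α₀ L := by
  obtain ⟨ρ, hρ⟩ := exists_esymm₃_eq (lineEsymm (algebraMap k (AlgebraicClosure k) A)
    (algebraMap k _ B) (algebraMap k _ α₁) (algebraMap k _ α₀))
  have hcK : algebraMap k (AlgebraicClosure k) (-c A B α₁ α₀ ^ 3) ≠ 0 :=
    (_root_.map_ne_zero _).mpr (neg_ne_zero.mpr (pow_ne_zero 3 hc))
  obtain ⟨L, hL⟩ := exists_isSymmSubst (hρ.trans (lineEsymm_map _ A B α₁ α₀))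
    (by rwa [eval₂Hom_prodLDen_eq_c hρ]) (prodL_eq (prodLDen_ne_zero hc) A) (prodLDen_symm α₁ α₀)
    (prodLNum_symm A α₁ α₀)
  refine ⟨L, hL, fun L' hL' ↦ ?_⟩
  apply Polynomial.map_injective (mapRingHom (algebraMap k _))
    (Polynomial.map_injective _ (algebraMap k (AlgebraicClosure k)).injective)
  apply mul_left_cancel₀ (C_ne_zero.mpr (C_ne_zero.mpr hcK))
  rw [IsProcL.map_eq hc hL' hρ, IsProcL.map_eq hc hL hρ]

end Procedure

section Correctness

variable {k : Type*} [Field k]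

lemma curve_polynomial (A B : k) :
    (curve A B).polynomial = Y ^ 2 - C (X ^ 3 + C A * X + C B) := by
  simp [WeierstrassCurve.Affine.polynomial, curve]

lemma neg_flipY_linePoly (γ β₁ β₀ : k) :
    -flipY (linePoly γ β₁ β₀) = C (C γ) * Y + C (C β₁ * X + C β₀) := by
  simp only [flipY, linePoly, sub_comp, mul_comp, C_comp, X_comp]
  ring

lemma toFun_line_ne_zero (A B : k) {γ : k} (hγ : γ ≠ 0) (β₁ β₀ : k) :
    toFun A B (C (C γ) * Y + C (C β₁ * X + C β₀)) ≠ 0 := by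
  have hdeg : (C (C γ) * Y + C (C β₁ * X + C β₀) : k[X][Y]).natDegree = 1 :=
    natDegree_linear (C_ne_zero.mpr hγ)
  rw [toFun, ne_eq, map_eq_zero_iff _ (IsFractionRing.injective _ _)]
  refine AdjoinRoot.mk_ne_zero_of_natDegree_lt WeierstrassCurve.Affine.monic_polynomial
    (ne_zero_of_natDegree_gt (hdeg ▸ Nat.zero_lt_one)) ?_
  rw [hdeg, WeierstrassCurve.Affine.natDegree_polynomial]
  exact one_lt_two

lemma map_eq_evalEval {K : Type*} [CommRing K] (θ : k[X][Y] →+* K) (g : k[X][Y]) :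
    θ g = (g.map (mapRingHom (θ.comp (C.comp C)))).evalEval (θ (C X)) (θ Y) := by
  have h : θ = (evalEvalRingHom (θ (C X)) (θ Y)).comp
      (mapRingHom (mapRingHom (θ.comp (C.comp C)))) := by
    ext <;> simp
  exact congrArg (· g) h

lemma map_flipY_eq_evalEval {K : Type*} [CommRing K] (θ : k[X][Y] →+* K) (g : k[X][Y]) :
    θ (flipY g) = (g.map (mapRingHom (θ.comp (C.comp C)))).evalEval (θ (C X)) (-θ Y) := by
  rw [map_eq_evalEval, flipY]
  simp [Polynomial.map_comp, evalEval, eval_comp]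

variable {A B α₁ α₀ : k}

lemma IsProcL.map_flipY_eq {K : Type*} [Field K] [IsAlgClosed K] (h3 : (3 : k) ≠ 0)
    (hc : c A B α₁ α₀ ≠ 0) {L : k[X][Y]} (hL : IsProcL A B α₁ α₀ L) {θ : k[X][Y] →+* K}
    (hθ : θ (curve A B).polynomial = 0) :
    θ (flipY L) = θ (C (C (-3 / c A B α₁ α₀ ^ 3)) *
        linePoly (d A B α₁ α₀) (v₁ A B α₁ α₀) (v₀ A B α₁ α₀)) *
      (θ (-flipY (linePoly 1 α₁ α₀)) *
        θ (-flipY (linePoly (c A B α₁ α₀) (u₁ A B α₁ α₀) (u₀ A B α₁ α₀)))) := by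
  set ι : k →+* K := θ.comp (C.comp C)
  have hCC (a : k) : θ (C (C a)) = ι a := rfl
  have hcurve : (-θ Y) ^ 2 = θ (C X) ^ 3 + ι A * θ (C X) + ι B := by
    rw [curve_polynomial, map_sub, sub_eq_zero] at hθ
    simpa [hCC] using hθ
  have h3K : (3 : K) ≠ 0 := by
    rw [← map_ofNat ι 3]
    exact (map_ne_zero ι).mpr h3
  obtain ⟨ρ, hρ⟩ := exists_esymm₃_eq (lineEsymm (ι A) (ι B) (ι α₁) (ι α₀))
  have hprod := congrArg (evalEvalRingHom (θ (C X)) (-θ Y)) (hL.map_eq hc hρ)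
  simp only [map_mul, map_prod, coe_evalEvalRingHom, evalEval_linePolyForm, evalEval_C,
    eval_C] at hprod
  rw [prod_lineForm h3K hρ hcurve, ← map_flipY_eq_evalEval θ L, ← map_c, ← map_d, ← map_u₁,
    ← map_u₀, ← map_v₁, ← map_v₀, map_neg, map_pow] at hprod
  have hcK : ι (c A B α₁ α₀) ≠ 0 := (map_ne_zero ι).mpr hc
  rw [neg_flipY_linePoly, neg_flipY_linePoly]
  simp only [linePoly, map_mul, map_add, map_sub, hCC, map_div₀, map_neg,
    map_ofNat, map_pow, map_one]
  field_simp
  linear_combination -hprod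

lemma IsProcL.toFun_flipY_eq (h3 : (3 : k) ≠ 0) (hc : c A B α₁ α₀ ≠ 0) {L : k[X][Y]}
    (hL : IsProcL A B α₁ α₀ L) :
    toFun A B (flipY L) = toFun A B (C (C (-3 / c A B α₁ α₀ ^ 3)) *
        linePoly (d A B α₁ α₀) (v₁ A B α₁ α₀) (v₀ A B α₁ α₀)) *
      (toFun A B (-flipY (linePoly 1 α₁ α₀)) *
        toFun A B (-flipY (linePoly (c A B α₁ α₀) (u₁ A B α₁ α₀) (u₀ A B α₁ α₀)))) := by
  let φ := algebraMap (curve A B).FunctionField (AlgebraicClosure (curve A B).FunctionField)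
  apply φ.injective
  simp only [map_mul φ]
  exact hL.map_flipY_eq h3 hc (θ := φ.comp ((algebraMap (curve A B).CoordinateRing _).comp
    (WeierstrassCurve.Affine.CoordinateRing.mk (curve A B)))) (by simp)

theorem procedure_correct (h3 : (3 : k) ≠ 0) (hc : c A B α₁ α₀ ≠ 0) :
    (∃! L : k[X][Y], IsProcL A B α₁ α₀ L) ∧ ∀ L : k[X][Y], IsProcL A B α₁ α₀ L →
      ∃ t : k, t ≠ 0 ∧ recovered A B α₁ α₀ L =
        toFun A B (C (C t) * linePoly (d A B α₁ α₀) (v₁ A B α₁ α₀) (v₀ A B α₁ α₀)) := by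
  refine ⟨existsUnique_isProcL hc, fun L hL ↦
    ⟨-3 / c A B α₁ α₀ ^ 3, div_ne_zero (neg_ne_zero.mpr h3) (pow_ne_zero 3 hc), ?_⟩⟩
  rw [recovered, hL.toFun_flipY_eq h3 hc, neg_flipY_linePoly, neg_flipY_linePoly]
  exact mul_div_cancel_right₀ _
    (mul_ne_zero (toFun_line_ne_zero A B one_ne_zero _ _) (toFun_line_ne_zero A B hc _ _))

end Correctness

section Divisors

open WeierstrassCurve.Affine
open scoped nonZeroDivisors

variable {K : Type*} [Field K] {W : WeierstrassCurve.Affine K}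

/-- The ideal of the coordinate ring of the functions that vanish at a point, as an invertible
fractional ideal; the point at infinity gives the unit ideal. -/
def pointIdeal : W.Point → (FractionalIdeal W.CoordinateRing⁰ W.FunctionField)ˣ
  | .zero => 1
  | .some _ _ h => CoordinateRing.XYIdeal' (W := W) h

/-- The divisor of the rational function `z` is the sum of the points of `s` plus a multiple of
the point at infinity. This is expressed through the factorization of the fractional ideal of `z`;
points at infinity in `s` do not count. -/
def HasDivisor (z : W.FunctionField) (s : Multiset W.Point) : Prop :=
  FractionalIdeal.spanSingleton W.CoordinateRing⁰ z = ((s.map pointIdeal).prod : _ˣ)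

lemma HasDivisor.mul {z w : W.FunctionField} {s t : Multiset W.Point} (hz : HasDivisor z s)
    (hw : HasDivisor w t) : HasDivisor (z * w) (s + t) := by
  rw [HasDivisor, ← FractionalIdeal.spanSingleton_mul_spanSingleton, hz, hw, Multiset.map_add,
    Multiset.prod_add, Units.val_mul]

lemma HasDivisor.prod {ι : Type*} [Fintype ι] {z : ι → W.FunctionField}
    {s : ι → Multiset W.Point} (h : ∀ i, HasDivisor (z i) (s i)) :
    HasDivisor (∏ i, z i) (∑ i, s i) := by
  classical
  induction (Finset.univ : Finset ι) using Finset.induction_on with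
  | empty => simp [HasDivisor]
  | insert i I hi ih =>
    rw [Finset.prod_insert hi, Finset.sum_insert hi]
    exact (h i).mul ih

lemma HasDivisor.of_mul {z w : W.FunctionField} {s t : Multiset W.Point}
    (h : HasDivisor (z * w) (s + t)) (hz : HasDivisor z s) : HasDivisor w t := by
  rw [HasDivisor, ← FractionalIdeal.spanSingleton_mul_spanSingleton, hz, Multiset.map_add,
    Multiset.prod_add, Units.val_mul] at h
  exact (Units.mul_right_inj _).mp h

lemma HasDivisor.algebraMap_mul {z : W.FunctionField} {s : Multiset W.Point} (hz : HasDivisor z s)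
    {t : K} (ht : t ≠ 0) : HasDivisor (algebraMap K W.FunctionField t * z) s := by
  refine (FractionalIdeal.spanSingleton_eq_spanSingleton.mpr
    ⟨(Units.mk0 t⁻¹ (inv_ne_zero ht)).map (algebraMap K W.CoordinateRing), ?_⟩).trans hz
  rw [Units.smul_def, Units.coe_map, MonoidHom.coe_coe, Algebra.smul_def,
    ← IsScalarTower.algebraMap_apply, ← mul_assoc, ← map_mul, Units.val_mk0, inv_mul_cancel₀ ht,
    map_one, one_mul]

variable (W) in
/-- The coordinate function `x` of the curve. -/
def xFun : W.FunctionField :=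
  algebraMap W.CoordinateRing W.FunctionField (CoordinateRing.mk W (C X))

variable (W) in
/-- The coordinate function `y` of the curve. -/
def yFun : W.FunctionField :=
  algebraMap W.CoordinateRing W.FunctionField (CoordinateRing.mk W Y)

variable (W) in
/-- The function `γ y - (β₁ x + β₀)` on the curve. -/
def lineFun (γ β₁ β₀ : K) : W.FunctionField :=
  algebraMap K _ γ * yFun W - (algebraMap K _ β₁ * xFun W + algebraMap K _ β₀)

lemma HasDivisor.of_lineFun_neg {γ β₁ β₀ : K} {s : Multiset W.Point}
    (h : HasDivisor (lineFun W (-γ) (-β₁) (-β₀)) s) : HasDivisor (lineFun W γ β₁ β₀) s := by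
  convert h.algebraMap_mul (neg_ne_zero.mpr one_ne_zero) using 1
  simp only [lineFun, map_neg, map_one]
  ring

lemma algebraMap_mk_C_C (a : K) : algebraMap W.CoordinateRing W.FunctionField
    (CoordinateRing.mk W (C (C a))) = algebraMap K W.FunctionField a := by
  rw [IsScalarTower.algebraMap_apply K W.CoordinateRing W.FunctionField]
  rfl

lemma coe_pointIdeal_some {x y : K} (h : W.Nonsingular x y) :
    (pointIdeal (.some x y h) : FractionalIdeal W.CoordinateRing⁰ W.FunctionField) =
      CoordinateRing.XYIdeal W x (C y) :=
  CoordinateRing.XYIdeal'_eq h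

lemma coe_pointIdeal_mul_neg {x y : K} (h : W.Nonsingular x y) :
    (pointIdeal (.some x y h) * pointIdeal (-.some x y h) :
      FractionalIdeal W.CoordinateRing⁰ W.FunctionField) = CoordinateRing.XIdeal W x := by
  rw [Point.neg_some, coe_pointIdeal_some, coe_pointIdeal_some, mul_comm,
    ← FractionalIdeal.coeIdeal_mul, CoordinateRing.XYIdeal_neg_mul h]

lemma hasDivisor_vertical {x y : K} (h : W.Nonsingular x y) :
    HasDivisor (xFun W - algebraMap K _ x) ({.some x y h} + {-.some x y h}) := by
  have hX : xFun W - algebraMap K _ x =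
      algebraMap W.CoordinateRing W.FunctionField (CoordinateRing.XClass W x) := by
    rw [CoordinateRing.XClass, C_sub, map_sub, map_sub, algebraMap_mk_C_C, xFun]
  rw [HasDivisor, hX, ← FractionalIdeal.coeIdeal_span_singleton, ← CoordinateRing.XIdeal,
    ← coe_pointIdeal_mul_neg h]
  simp

lemma hasDivisor_chord [DecidableEq K] {x₁ y₁ x₂ y₂ : K} (h₁ : W.Nonsingular x₁ y₁)
    (h₂ : W.Nonsingular x₂ y₂) (hxy : ¬(x₁ = x₂ ∧ y₁ = W.negY x₂ y₂)) :
    HasDivisor (lineFun W 1 (W.slope x₁ x₂ y₁ y₂) (y₁ - W.slope x₁ x₂ y₁ y₂ * x₁))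
      ({.some x₁ y₁ h₁} + {.some x₂ y₂ h₂} + {-(.some x₁ y₁ h₁ + .some x₂ y₂ h₂)}) := by
  have hY : lineFun W 1 (W.slope x₁ x₂ y₁ y₂) (y₁ - W.slope x₁ x₂ y₁ y₂ * x₁) =
      algebraMap W.CoordinateRing W.FunctionField
        (CoordinateRing.YClass W (linePolynomial x₁ y₁ (W.slope x₁ x₂ y₁ y₂))) := by
    simp only [CoordinateRing.YClass, linePolynomial, lineFun, xFun, yFun, map_sub, map_add,
      map_mul, map_one, algebraMap_mk_C_C]
    ring
  have hQ := nonsingular_add h₁ h₂ hxy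
  rw [Point.add_some hxy, HasDivisor, hY, ← FractionalIdeal.coeIdeal_span_singleton,
    ← CoordinateRing.YIdeal, ← Units.mul_left_inj (pointIdeal (.some _ _ hQ)),
    coe_pointIdeal_some, ← FractionalIdeal.coeIdeal_mul,
    ← CoordinateRing.XYIdeal_mul_XYIdeal h₁.1 h₂.1 hxy, FractionalIdeal.coeIdeal_mul,
    ← coe_pointIdeal_mul_neg hQ, FractionalIdeal.coeIdeal_mul, ← coe_pointIdeal_some h₁,
    ← coe_pointIdeal_some h₂]
  simp only [Multiset.map_add, Multiset.map_singleton, Multiset.prod_add, Multiset.prod_singleton,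
    Units.val_mul, coe_pointIdeal_some]
  ring

lemma exists_algebraMap_eq_of_isUnit {z : W.CoordinateRing} (hz : IsUnit z) :
    ∃ t : K, algebraMap K W.CoordinateRing t = z := by
  obtain ⟨p, q, rfl⟩ := CoordinateRing.exists_smul_basis_eq z
  have hdeg := CoordinateRing.degree_norm_smul_basis (W' := W) p q
  rw [degree_eq_zero_of_isUnit (hz.map (Algebra.norm K[X]))] at hdeg
  have hq : q = 0 := by
    by_contra hq
    have := le_max_right (2 • p.degree) (2 • q.degree + 3)
    rw [← hdeg, degree_eq_natDegree hq] at this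
    norm_cast at this
  have hp : p.degree ≤ 0 := by
    rcases eq_or_ne p 0 with rfl | hp
    · simp
    have := le_max_left (2 • p.degree) (2 • q.degree + 3)
    rw [← hdeg, two_nsmul, degree_eq_natDegree hp] at this
    rw [degree_eq_natDegree hp]
    norm_cast at this ⊢
    omega
  refine ⟨p.coeff 0, ?_⟩
  rw [hq, zero_smul, add_zero, eq_C_of_degree_le_zero hp, coeff_C_zero, CoordinateRing.smul,
    mul_one]
  rfl

lemma lineFun_injective {γ β₁ β₀ γ' β₁' β₀' : K}
    (h : lineFun W γ β₁ β₀ = lineFun W γ' β₁' β₀') : γ = γ' ∧ β₁ = β₁' ∧ β₀ = β₀' := by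
  have hzero : algebraMap W.CoordinateRing W.FunctionField
      ((C (β₁' - β₁) * X + C (β₀' - β₀)) • 1 + C (γ - γ') • CoordinateRing.mk W Y) = 0 := by
    rw [← sub_eq_zero.mpr h]
    simp only [lineFun, xFun, yFun, CoordinateRing.smul, ← algebraMap_mk_C_C, ← map_mul, ← map_add,
      ← map_sub, mul_one]
    congr 2
    simp only [map_sub, map_add, map_mul]
    ring
  obtain ⟨hl, hγ⟩ := CoordinateRing.smul_basis_eq_zero
    ((map_eq_zero_iff _ (IsFractionRing.injective _ _)).mp hzero)
  have h₁ := congrArg (coeff · 1) hl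
  have h₀ := congrArg (coeff · 0) hl
  simp only [map_sub, coeff_add, coeff_mul_X, coeff_sub, coeff_C_zero, coeff_C_succ, sub_self,
    add_zero, coeff_zero, sub_eq_zero, mul_coeff_zero, coeff_X_zero, mul_zero, zero_add,
    C_inj] at h₁ h₀ hγ
  exact ⟨hγ, h₁.symm, h₀.symm⟩

lemma HasDivisor.lineFun_eq {γ β₁ β₀ β₁' β₀' : K} {s : Multiset W.Point}
    (h : HasDivisor (lineFun W γ β₁ β₀) s) (h' : HasDivisor (lineFun W 1 β₁' β₀') s) :
    γ ≠ 0 ∧ β₁ / γ = β₁' ∧ β₀ / γ = β₀' := by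
  obtain ⟨z, hz⟩ := FractionalIdeal.spanSingleton_eq_spanSingleton.mp (h'.trans h.symm)
  obtain ⟨t, ht⟩ := exists_algebraMap_eq_of_isUnit z.isUnit
  have hscale : lineFun W t (t * β₁') (t * β₀') = lineFun W γ β₁ β₀ := by
    rw [← hz, Units.smul_def, ← ht, algebraMap_smul, Algebra.smul_def]
    simp only [lineFun, map_mul, map_one]
    ring
  have ht0 : t ≠ 0 := by
    rintro rfl
    exact z.ne_zero (by rw [← ht, map_zero])
  obtain ⟨rfl, rfl, rfl⟩ := lineFun_injective hscale
  exact ⟨ht0, mul_div_cancel_left₀ _ ht0, mul_div_cancel_left₀ _ ht0⟩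

end Divisors

section ShortWeierstrass

open WeierstrassCurve WeierstrassCurve.Affine

instance isShortNF_baseChange_curve {F K : Type*} [Field F] [Field K] [Algebra F K] (A B : F) :
    WeierstrassCurve.IsShortNF ((curve A B).baseChange K) :=
  ⟨map_zero _, map_zero _, map_zero _⟩

variable {K : Type*} [Field K] {W : WeierstrassCurve.Affine K}

/-- The line `y = l x + m` meets the curve in the points `(x i, y i)`, counted with multiplicity.
The multiplicities are encoded in the elementary symmetric functions of the `x i`. -/
structure IsLineSection (W : WeierstrassCurve.Affine K) (l m : K) (x y : Fin 3 → K) : Prop where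
  y_eq (i : Fin 3) : y i = l * x i + m
  esymm₃_eq : esymm₃ x = lineEsymm W.a₄ W.a₆ l m

lemma IsLineSection.neg {l m : K} {x y : Fin 3 → K} (h : IsLineSection W l m x y) :
    IsLineSection W (-l) (-m) x (-y) where
  y_eq i := by rw [Pi.neg_apply, h.y_eq i]; ring
  esymm₃_eq := by
    rw [h.esymm₃_eq, lineEsymm, lineEsymm, neg_sq, neg_sq]
    ring_nf

lemma IsLineSection.algebraMap_y {l m : K} {x y : Fin 3 → K} (h : IsLineSection W l m x y)
    {L : Type*} [CommRing L] [Algebra K L] (i : Fin 3) :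
    algebraMap K L (y i) = algebraMap K L l * algebraMap K L (x i) + algebraMap K L m := by
  rw [h.y_eq, map_add, map_mul]

lemma IsLineSection.esymm₃_algebraMap {l m : K} {x y : Fin 3 → K} (h : IsLineSection W l m x y)
    {L : Type*} [CommRing L] [Algebra K L] :
    esymm₃ (fun i ↦ algebraMap K L (x i)) = lineEsymm (algebraMap K L W.a₄) (algebraMap K L W.a₆)
      (algebraMap K L l) (algebraMap K L m) := by
  rw [lineEsymm_map, ← h.esymm₃_eq]
  exact esymm₃_comp _ x

lemma esymm₃_eq_lineEsymm_iff {a b l m : K} {x : Fin 3 → K} :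
    esymm₃ x = lineEsymm a b l m ↔
      cubic a b - (C l * X + C m) ^ 2 = ∏ i, (X - C (x i)) := by
  have hcubic : cubic a b - (C l * X + C m) ^ 2 =
      Cubic.toPoly ⟨1, -l ^ 2, a - 2 * m * l, -(m ^ 2 - b)⟩ := by
    simp only [cubic, Cubic.toPoly, map_sub, map_pow, map_mul, map_neg, map_ofNat, map_one]
    ring
  rw [hcubic, Fin.prod_univ_three, Cubic.prod_X_sub_C_eq, Cubic.toPoly_injective, Cubic.mk.injEq,
    esymm₃, lineEsymm]
  simp only [Matrix.vecCons_inj]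
  grind

lemma slope_mul_sub_add [DecidableEq K] {x₁ y₁ x₂ y₂ : K} (h₁ : W.Equation x₁ y₁)
    (h₂ : W.Equation x₂ y₂) (hxy : ¬(x₁ = x₂ ∧ y₁ = W.negY x₂ y₂)) :
    W.slope x₁ x₂ y₁ y₂ * (x₂ - x₁) + y₁ = y₂ := by
  rcases eq_or_ne x₁ x₂ with hx | hx
  · rw [hx, sub_self, mul_zero, zero_add, Y_eq_of_Y_ne h₁ h₂ hx fun hy ↦ hxy ⟨hx, hy⟩]
  · rw [slope_of_X_ne hx, ← neg_sub x₁ x₂, mul_neg, div_mul_cancel₀ _ (sub_ne_zero.mpr hx)]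
    ring

variable [WeierstrassCurve.IsShortNF W]

lemma negY_of_isShortNF (x y : K) : W.negY x y = -y := by
  simp [negY]

lemma nonsingular_neg_of_isShortNF {x y : K} (h : W.Nonsingular x y) : W.Nonsingular x (-y) := by
  rwa [← negY_of_isShortNF (W := W) x, nonsingular_neg]

lemma some_neg {x y : K} (h : W.Nonsingular x y) :
    (.some x (-y) (nonsingular_neg_of_isShortNF h) : W.Point) = -.some x y h := by
  rw [Point.neg_some, Point.some.injEq, negY_of_isShortNF]
  exact ⟨rfl, rfl⟩

lemma equation_iff_of_isShortNF (x y : K) :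
    W.Equation x y ↔ y ^ 2 = x ^ 3 + W.a₄ * x + W.a₆ := by
  simp [equation_iff]

lemma deriv_ne_zero_of_nonsingular {x y : K} (h : W.Nonsingular x y) (hy : 2 * y = 0) :
    3 * x ^ 2 + W.a₄ ≠ 0 := by
  have := (nonsingular_iff ..).mp h
  simp only [a₁_of_isShortNF, a₂_of_isShortNF, a₃_of_isShortNF] at this
  grind

lemma yFun_sq : yFun W ^ 2 = xFun W ^ 3 + algebraMap K _ W.a₄ * xFun W + algebraMap K _ W.a₆ := by
  rw [← sub_eq_zero, ← map_zero (algebraMap W.CoordinateRing W.FunctionField),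
    ← AdjoinRoot.mk_self (f := W.polynomial), xFun, yFun]
  simp only [← algebraMap_mk_C_C, ← map_pow, ← map_mul, ← map_add, ← map_sub]
  congr 2
  simp [WeierstrassCurve.Affine.polynomial]

variable [DecidableEq K]

section IsLineSection

variable {l m : K} {x y : Fin 3 → K} (hns : ∀ i, W.Nonsingular (x i) (y i))

include hns in
lemma IsLineSection.slope_eq (h : IsLineSection W l m x y) :
    ¬(x 0 = x 1 ∧ y 0 = W.negY (x 1) (y 1)) ∧ W.slope (x 0) (x 1) (y 0) (y 1) = l := by
  have he := h.esymm₃_eq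
  have h0 := h.y_eq 0
  have h1 := h.y_eq 1
  simp only [esymm₃, lineEsymm, Matrix.vecCons_inj] at he
  rw [negY_of_isShortNF]
  rcases eq_or_ne (x 0) (x 1) with hx | hx
  · have htangent : 3 * x 0 ^ 2 + W.a₄ = l * (2 * y 0) := by grind
    have hy : 2 * y 0 ≠ 0 := fun hy ↦
      deriv_ne_zero_of_nonsingular (hns 0) hy (by rw [htangent, hy, mul_zero])
    have hneg : y 0 ≠ -y 1 := by grind
    refine ⟨fun hxy ↦ hneg hxy.2, ?_⟩
    rw [slope_of_Y_ne hx (by rwa [negY_of_isShortNF]), negY_of_isShortNF, sub_neg_eq_add,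
      ← two_mul, div_eq_iff hy, ← htangent, a₁_of_isShortNF, a₂_of_isShortNF]
    ring
  · refine ⟨fun hxy ↦ hx hxy.1, ?_⟩
    rw [slope_of_X_ne hx, div_eq_iff (sub_ne_zero.mpr hx), h0, h1]
    ring

omit [DecidableEq K] in
include hns in
lemma IsLineSection.unique {l' m' : K} (h : IsLineSection W l m x y)
    (h' : IsLineSection W l' m' x y) : l = l' ∧ m = m' := by
  classical
  obtain rfl := (h.slope_eq hns).2.symm.trans (h'.slope_eq hns).2
  exact ⟨rfl, add_left_cancel ((h.y_eq 0).symm.trans (h'.y_eq 0))⟩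

lemma neg_add_some {x₁ y₁ x₂ y₂ : K} {h₁ : W.Nonsingular x₁ y₁} {h₂ : W.Nonsingular x₂ y₂}
    (hxy : ¬(x₁ = x₂ ∧ y₁ = W.negY x₂ y₂)) {x₃ y₃ : K} {h₃ : W.Nonsingular x₃ y₃} :
    -(Point.some x₁ y₁ h₁ + Point.some x₂ y₂ h₂) = .some x₃ y₃ h₃ ↔
      x₃ = W.slope x₁ x₂ y₁ y₂ ^ 2 - x₁ - x₂ ∧ y₃ = W.slope x₁ x₂ y₁ y₂ * (x₃ - x₁) + y₁ := by
  rw [Point.add_some hxy, Point.neg_some, Point.some.injEq, addY, negY_of_isShortNF,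
    negY_of_isShortNF, neg_neg, negAddY, addX, a₁_of_isShortNF, a₂_of_isShortNF]
  grind

omit [DecidableEq K] in
lemma IsLineSection.hasDivisor (h : IsLineSection W l m x y) :
    HasDivisor (lineFun W 1 l m) (∑ i, {.some (x i) (y i) (hns i)}) := by
  classical
  obtain ⟨hxy, hl⟩ := h.slope_eq hns
  have he := congrFun h.esymm₃_eq 0
  have hchord := hasDivisor_chord (hns 0) (hns 1) hxy
  have hP₂ : -(Point.some _ _ (hns 0) + Point.some _ _ (hns 1)) = .some _ _ (hns 2) :=
    (neg_add_some hxy).mpr (by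
      rw [hl, h.y_eq 2, h.y_eq 0]
      simp only [esymm₃, lineEsymm, Matrix.cons_val_zero] at he
      exact ⟨by linear_combination he, by ring⟩)
  rwa [hl, hP₂, sub_eq_of_eq_add' (h.y_eq 0), ← Fin.sum_univ_three
    fun i ↦ ({.some (x i) (y i) (hns i)} : Multiset W.Point)] at hchord

lemma exists_isLineSection (hsum : ∑ i, (.some (x i) (y i) (hns i) : W.Point) = 0) :
    ∃ l m : K, IsLineSection W l m x y := by
  rw [Fin.sum_univ_three] at hsum
  have hxy : ¬(x 0 = x 1 ∧ y 0 = W.negY (x 1) (y 1)) := by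
    rintro ⟨hx, hy⟩
    rw [Point.add_of_Y_eq hx hy, zero_add] at hsum
    exact Point.some_ne_zero _ hsum
  obtain ⟨hx₂, hy₂⟩ := (neg_add_some hxy).mp (neg_eq_of_add_eq_zero_right hsum)
  have hy₁ := slope_mul_sub_add (hns 0).1 (hns 1).1 hxy
  have hcubic := addPolynomial_slope (hns 0).1 (hns 1).1 hxy
  rw [addX, a₁_of_isShortNF, a₂_of_isShortNF, zero_mul, add_zero, sub_zero, ← hx₂,
    addPolynomial_eq, Cubic.prod_X_sub_C_eq, neg_inj, Cubic.toPoly_injective, Cubic.mk.injEq,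
    a₁_of_isShortNF, a₂_of_isShortNF, a₃_of_isShortNF] at hcubic
  obtain ⟨-, -, h₂, h₃⟩ := hcubic
  generalize W.slope (x 0) (x 1) (y 0) (y 1) = l at *
  refine ⟨l, y 0 - l * x 0, fun i ↦ ?_, ?_⟩
  · fin_cases i
    all_goals simp only [Fin.mk_zero, Fin.mk_one, Fin.reduceFinMk]
    · ring
    · linear_combination -hy₁
    · linear_combination hy₂
  · simp only [esymm₃, lineEsymm, Matrix.vecCons_inj]
    exact ⟨by linear_combination hx₂, by linear_combination -h₂, by linear_combination h₃, trivial⟩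

end IsLineSection

section MultiplesOfPoints

omit [WeierstrassCurve.IsShortNF W] [DecidableEq K] in
lemma HasDivisor.add_zero {z : W.FunctionField} {s : Multiset W.Point} (h : HasDivisor z s) :
    HasDivisor z (s + {0}) := by
  rw [HasDivisor, h, Multiset.map_add, Multiset.map_singleton, Multiset.prod_add,
    Multiset.prod_singleton, show pointIdeal (0 : W.Point) = 1 from rfl, mul_one]

omit [WeierstrassCurve.IsShortNF W] in
lemma hasDivisor_chord_of_slope {x₁ y₁ x₂ y₂ : K} (h₁ : W.Nonsingular x₁ y₁)
    (h₂ : W.Nonsingular x₂ y₂) (hxy : ¬(x₁ = x₂ ∧ y₁ = W.negY x₂ y₂)) {a b : K} (hb : b ≠ 0)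
    (hslope : W.slope x₁ x₂ y₁ y₂ = -a / b) :
    HasDivisor (algebraMap K _ a * (xFun W - algebraMap K _ x₁) +
        algebraMap K _ b * (yFun W - algebraMap K _ y₁))
      ({.some x₁ y₁ h₁} + {.some x₂ y₂ h₂} + {-(.some x₁ y₁ h₁ + .some x₂ y₂ h₂)}) := by
  convert (hasDivisor_chord h₁ h₂ hxy).algebraMap_mul hb using 1
  have ha : a = -(b * W.slope x₁ x₂ y₁ y₂) := by
    rw [hslope, mul_div_cancel₀ _ hb, neg_neg]
  rw [ha, lineFun]
  simp only [map_neg, map_mul, map_sub, map_one]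
  ring

variable {x y : K} (h : W.Nonsingular x y)

include h in
lemma two_nsmul_some_of_two_mul_eq_zero (hy : 2 * y = 0) : 2 • (.some x y h : W.Point) = 0 := by
  rw [two_nsmul, Point.add_self_of_Y_eq]
  rw [negY_of_isShortNF]
  linear_combination hy

omit [DecidableEq K] in
lemma ne_negY_self (hy : 2 * y ≠ 0) : y ≠ W.negY x y := by
  rw [negY_of_isShortNF]
  grind

lemma slope_self (hy : 2 * y ≠ 0) : W.slope x x y y = (3 * x ^ 2 + W.a₄) / (2 * y) := by
  rw [slope_of_Y_ne rfl (ne_negY_self hy), negY_of_isShortNF, a₁_of_isShortNF, a₂_of_isShortNF]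
  ring

lemma two_nsmul_some (hy : 2 * y ≠ 0) :
    ∃ h', 2 • (.some x y h : W.Point) = .some (dblX W.a₄ x y) (dblY W.a₄ x y) h' := by
  have hadd := nonsingular_add h h fun hxy ↦ ne_negY_self hy hxy.2
  have hx : W.addX x x (W.slope x x y y) = dblX W.a₄ x y := by
    rw [slope_self hy, addX, dblX, a₁_of_isShortNF, a₂_of_isShortNF]
    ring
  have hy' : W.addY x x y (W.slope x x y y) = dblY W.a₄ x y := by
    rw [addY, negAddY, negY_of_isShortNF, hx, slope_self hy, dblY]
    ring
  refine ⟨hx ▸ hy' ▸ hadd, ?_⟩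
  rw [two_nsmul, Point.add_self_of_Y_ne (ne_negY_self hy), Point.some.injEq]
  exact ⟨hx, hy'⟩

lemma hasDivisor_tangent :
    HasDivisor (tangentForm (algebraMap K _ W.a₄) (algebraMap K _ x) (algebraMap K _ y)
      (xFun W) (yFun W))
      ({.some x y h} + {.some x y h} + {-(2 • (.some x y h : W.Point))}) := by
  have htangent : tangentForm (algebraMap K _ W.a₄) (algebraMap K _ x) (algebraMap K _ y)
      (xFun W) (yFun W) = algebraMap K _ (3 * x ^ 2 + W.a₄) * (xFun W - algebraMap K _ x) +
        algebraMap K _ (-(2 * y)) * (yFun W - algebraMap K _ y) := by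
    simp only [tangentForm, map_add, map_mul, map_neg, map_pow, map_ofNat]
    ring
  rw [htangent]
  by_cases hy : 2 * y = 0
  · have hP := two_nsmul_some_of_two_mul_eq_zero h hy
    have hneg : -(.some x y h : W.Point) = .some x y h :=
      neg_eq_of_add_eq_zero_right (by rw [← two_nsmul, hP])
    have hvert := (hasDivisor_vertical h).algebraMap_mul (deriv_ne_zero_of_nonsingular h hy)
    rw [hneg] at hvert
    rw [hP, hy, neg_zero, neg_zero, map_zero, zero_mul, _root_.add_zero]
    exact hvert.add_zero
  · rw [two_nsmul]
    exact hasDivisor_chord_of_slope h h (fun hxy ↦ ne_negY_self hy hxy.2) (neg_ne_zero.mpr hy)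
      (by rw [slope_self hy, neg_div_neg_eq])

lemma two_nsmul_some_of_psiNum_eq_zero (hy : 2 * y ≠ 0) (hψ : psiNum W.a₄ x y = 0) :
    2 • (.some x y h : W.Point) = -.some x y h := by
  have h2 : (2 : K) ≠ 0 := left_ne_zero_of_mul hy
  have hy0 : y ≠ 0 := right_ne_zero_of_mul hy
  obtain ⟨h', hP⟩ := two_nsmul_some h hy
  have hx : dblX W.a₄ x y = x := by
    rw [eq_comm, ← sub_eq_zero, sub_dblX h2 _ _ hy0, hψ, mul_zero, mul_zero]
  have hne : dblY W.a₄ x y ≠ y := by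
    rw [← sub_ne_zero, dblY_sub h2 _ _ hy0, slopeNum_of_psiNum_eq_zero hψ]
    exact mul_ne_zero (inv_ne_zero (pow_ne_zero _ hy)) (neg_ne_zero.mpr (pow_ne_zero _ hy))
  rw [hP, Point.neg_some, Point.some.injEq]
  exact ⟨hx, (Y_eq_of_X_eq h'.1 h.1 hx).resolve_left hne⟩

lemma hasDivisor_lineForm :
    HasDivisor (lineForm (algebraMap K _ W.a₄) (algebraMap K _ x) (algebraMap K _ y)
      (xFun W) (yFun W))
      ({.some x y h} + {2 • (.some x y h : W.Point)} + {-(3 • (.some x y h : W.Point))}) := by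
  have hline : lineForm (algebraMap K _ W.a₄) (algebraMap K _ x) (algebraMap K _ y)
      (xFun W) (yFun W) = algebraMap K _ (slopeNum W.a₄ x y) * (xFun W - algebraMap K _ x) +
        algebraMap K _ (2 * y * psiNum W.a₄ x y) * (yFun W - algebraMap K _ y) := by
    simp only [lineForm, slopeNum, psiNum, map_add, map_sub, map_mul, map_pow, map_ofNat]
  have hvertical {a : K} (ha : a ≠ 0) := ((hasDivisor_vertical h).algebraMap_mul ha).add_zero
  rw [hline, succ_nsmul' (.some x y h : W.Point) 2]
  by_cases hy : 2 * y = 0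
  · rw [two_nsmul_some_of_two_mul_eq_zero h hy, hy, zero_mul, map_zero, zero_mul, _root_.add_zero,
      _root_.add_zero, add_right_comm, slopeNum_of_two_mul_eq_zero hy]
    exact hvertical (neg_ne_zero.mpr (pow_ne_zero _ (deriv_ne_zero_of_nonsingular h hy)))
  by_cases hψ : psiNum W.a₄ x y = 0
  · rw [two_nsmul_some_of_psiNum_eq_zero h hy hψ, hψ, mul_zero, map_zero, zero_mul,
      _root_.add_zero, add_neg_cancel, neg_zero, slopeNum_of_psiNum_eq_zero hψ]
    exact hvertical (neg_ne_zero.mpr (pow_ne_zero _ hy))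
  obtain ⟨h', hP⟩ := two_nsmul_some h hy
  have hX := sub_dblX (left_ne_zero_of_mul hy) W.a₄ x (right_ne_zero_of_mul hy)
  have hY := dblY_sub (left_ne_zero_of_mul hy) W.a₄ x (right_ne_zero_of_mul hy)
  have hx : x ≠ dblX W.a₄ x y := by
    rw [← sub_ne_zero, hX]
    positivity
  rw [hP]
  refine hasDivisor_chord_of_slope h h' (fun hxy ↦ hx hxy.1) (mul_ne_zero hy hψ) ?_
  rw [slope_of_X_ne hx, hX, ← neg_sub, hY]
  field_simp

end MultiplesOfPoints

section MultiplesOfLineSections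

variable {l m : K} {x y : Fin 3 → K} {hns : ∀ i, W.Nonsingular (x i) (y i)} {P : Fin 3 → W.Point}

lemma IsLineSection.hasDivisor_neg_two_nsmul (h : IsLineSection W l m x y)
    (hP : ∀ i, P i = .some (x i) (y i) (hns i)) :
    HasDivisor (lineFun W (c W.a₄ W.a₆ l m) (-u₁ W.a₄ W.a₆ l m) (-u₀ W.a₄ W.a₆ l m))
      (∑ i, {-(2 • P i)}) := by
  simp only [hP]
  have hprod := HasDivisor.prod fun i ↦ hasDivisor_tangent (hns i)
  have hline := h.hasDivisor hns
  simp only [h.algebraMap_y] at hprod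
  rw [prod_tangentForm h.esymm₃_algebraMap yFun_sq, Finset.sum_add_distrib,
    Finset.sum_add_distrib] at hprod
  refine HasDivisor.of_mul ?_ (hline.mul hline)
  convert hprod using 1
  simp only [lineFun, map_one, map_neg, map_c, map_u₁, map_u₀]
  ring

theorem IsLineSection.hasDivisor_two_nsmul (h : IsLineSection W l m x y)
    (hP : ∀ i, P i = .some (x i) (y i) (hns i)) :
    HasDivisor (lineFun W (c W.a₄ W.a₆ l m) (u₁ W.a₄ W.a₆ l m) (u₀ W.a₄ W.a₆ l m))
      (∑ i, {2 • P i}) := by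
  have hneg := h.neg.hasDivisor_neg_two_nsmul (P := -P) fun i ↦
    (congrArg Neg.neg (hP i)).trans (some_neg (hns i)).symm
  simp only [Pi.neg_apply, smul_neg, neg_neg, c_neg, u₁_neg, u₀_neg] at hneg
  exact hneg.of_lineFun_neg

lemma IsLineSection.hasDivisor_neg_three_nsmul (h3 : (3 : K) ≠ 0) (h : IsLineSection W l m x y)
    (hP : ∀ i, P i = .some (x i) (y i) (hns i)) :
    HasDivisor (lineFun W (d W.a₄ W.a₆ l m) (-v₁ W.a₄ W.a₆ l m) (-v₀ W.a₄ W.a₆ l m))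
      (∑ i, {-(3 • P i)}) := by
  have h2P := h.hasDivisor_two_nsmul hP
  simp only [hP] at h2P ⊢
  have hprod := HasDivisor.prod fun i ↦ hasDivisor_lineForm (hns i)
  have h3' : (3 : W.FunctionField) ≠ 0 := by
    rw [← map_ofNat (algebraMap K W.FunctionField) 3]
    exact (_root_.map_ne_zero _).mpr h3
  simp only [h.algebraMap_y] at hprod
  rw [prod_lineForm h3' h.esymm₃_algebraMap yFun_sq, Finset.sum_add_distrib,
    Finset.sum_add_distrib] at hprod
  refine HasDivisor.of_mul ?_ ((h.hasDivisor hns).mul h2P)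
  convert hprod.algebraMap_mul (neg_ne_zero.mpr (inv_ne_zero h3)) using 1
  simp only [lineFun, map_one, map_neg, map_inv₀, map_ofNat, map_c, map_u₁, map_u₀, map_d, map_v₁,
    map_v₀]
  field_simp
  ring

theorem IsLineSection.hasDivisor_three_nsmul (h3 : (3 : K) ≠ 0) (h : IsLineSection W l m x y)
    (hP : ∀ i, P i = .some (x i) (y i) (hns i)) :
    HasDivisor (lineFun W (d W.a₄ W.a₆ l m) (v₁ W.a₄ W.a₆ l m) (v₀ W.a₄ W.a₆ l m))
      (∑ i, {3 • P i}) := by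
  have hneg := h.neg.hasDivisor_neg_three_nsmul h3 (P := -P) fun i ↦
    (congrArg Neg.neg (hP i)).trans (some_neg (hns i)).symm
  simpa only [Pi.neg_apply, smul_neg, neg_neg, d_neg, v₁_neg, v₀_neg] using hneg

end MultiplesOfLineSections

end ShortWeierstrass

section Frobenius

open WeierstrassCurve.Affine

lemma IsLineSection.comp_perm {K : Type*} [Field K] {W : WeierstrassCurve.Affine K} {l m : K}
    {x y : Fin 3 → K} (h : IsLineSection W l m x y) (e : Equiv.Perm (Fin 3)) :
    IsLineSection W l m (x ∘ e) (y ∘ e) where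
  y_eq i := h.y_eq (e i)
  esymm₃_eq := esymm₃_eq_lineEsymm_iff.mpr <| (esymm₃_eq_lineEsymm_iff.mp h.esymm₃_eq).trans
    (Equiv.prod_comp e fun i ↦ X - C (x i)).symm

lemma IsLineSection.map {K L : Type*} [Field K] [Field L] {W : WeierstrassCurve.Affine K} {l m : K}
    {x y : Fin 3 → K} (h : IsLineSection W l m x y) (φ : K →+* L) :
    IsLineSection (W.map φ) (φ l) (φ m) (φ ∘ x) (φ ∘ y) where
  y_eq i := by rw [Function.comp_apply, h.y_eq, map_add, map_mul, Function.comp_apply]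
  esymm₃_eq := by
    rw [esymm₃_comp, h.esymm₃_eq, ← lineEsymm_map]
    rfl

variable {F K : Type*} [Field F] [Fintype F] [Field K] [Algebra F K]

lemma frobeniusAlgHom_iterate_finrank [FiniteDimensional F K] (x : K) :
    (FiniteField.frobeniusAlgHom F K)^[Module.finrank F K] x = x := by
  have : Finite K := Module.finite_of_finite F
  rw [← AlgHom.coe_pow, ← FiniteField.orderOf_frobeniusAlgHom, pow_orderOf_eq_one]
  rfl

lemma mem_range_algebraMap_of_frobeniusAlgHom_eq {x : K}
    (hx : FiniteField.frobeniusAlgHom F K x = x) : x ∈ (algebraMap F K).range := by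
  refine Polynomial.splits_X_pow_nat_card_sub_X.mem_range_of_isRoot
    (FiniteField.X_pow_card_sub_X_ne_zero F Finite.one_lt_card) ?_
  rw [FiniteField.coe_frobeniusAlgHom, ← Nat.card_eq_fintype_card] at hx
  simpa [IsRoot, sub_eq_zero] using hx

variable [DecidableEq K] {A B : F}

lemma frob_injective : Function.Injective (frob K A B) :=
  Point.map_injective _

lemma frob_iterate_some {x y : K} (hns : ((curve A B).baseChange K).Nonsingular x y) (n : ℕ) :
    ∃ hns', (frob K A B)^[n] (.some x y hns) = .some ((FiniteField.frobeniusAlgHom F K)^[n] x)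
      ((FiniteField.frobeniusAlgHom F K)^[n] y) hns' := by
  induction n with
  | zero => exact ⟨hns, rfl⟩
  | succ n ih =>
    obtain ⟨_, ih⟩ := ih
    refine ⟨?_, ?_⟩
    · rw [Function.iterate_succ_apply', Function.iterate_succ_apply']
      exact (baseChange_nonsingular _ (FiniteField.frobeniusAlgHom F K).injective _ _).mpr ‹_›
    · simp only [Function.iterate_succ_apply', ih]
      rfl

lemma frob_iterate_finrank [FiniteDimensional F K] :
    ∀ P : Points K A B, (frob K A B)^[Module.finrank F K] P = P
  | .zero => iterate_map_zero ..
  | .some _ _ hns => by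
    obtain ⟨_, h⟩ := frob_iterate_some hns (Module.finrank F K)
    simp only [h, frobeniusAlgHom_iterate_finrank]

/-- The Frobenius conjugates `P`, `φ(P)`, `φ²(P)` of a point over the cubic extension. -/
def frobConj (P : Points K A B) (i : Fin 3) : Points K A B :=
  (frob K A B)^[i] P

lemma frobConj_nsmul (n : ℕ) (P : Points K A B) (i : Fin 3) :
    frobConj (n • P) i = n • frobConj P i :=
  iterate_map_nsmul ..

lemma frobConj_ne_zero {P : Points K A B} (hP : P ≠ 0) (i : Fin 3) : frobConj P i ≠ 0 := by
  rw [frobConj, ← iterate_map_zero (frob K A B) i]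
  exact (frob_injective.iterate i).ne hP

lemma frob_frobConj (hK : Module.finrank F K = 3) (P : Points K A B) (i : Fin 3) :
    frob K A B (frobConj P i) = frobConj P (i + 1) := by
  have : FiniteDimensional F K := Module.finite_of_finrank_pos (by omega)
  rw [frobConj, ← Function.iterate_succ_apply' (f := frob K A B)]
  fin_cases i
  · rfl
  · rfl
  · exact (congrArg ((frob K A B)^[·] P) hK.symm).trans (frob_iterate_finrank P)

lemma mem_T₃_iff {P : Points K A B} : P ∈ T₃ K A B ↔ ∑ i, frobConj P i = 0 := by
  rw [Fin.sum_univ_three]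
  rfl

lemma exists_frobConj_eq_some {P : Points K A B} (hP : P ≠ 0) :
    ∃ (x y : Fin 3 → K) (hns : ∀ i, ((curve A B).baseChange K).Nonsingular (x i) (y i)),
      ∀ i, frobConj P i = .some (x i) (y i) (hns i) := by
  have hcoord : ∀ Q : Points K A B, Q ≠ 0 → ∃ x y hns, Q = .some x y hns
    | .zero, hQ => absurd rfl hQ
    | .some x y hns, _ => ⟨x, y, hns, rfl⟩
  choose x y hns h using fun i ↦ hcoord _ (frobConj_ne_zero hP i)
  exact ⟨x, y, hns, h⟩

section Coordinates

variable {P : Points K A B} {x y : Fin 3 → K}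
  {hns : ∀ i, ((curve A B).baseChange K).Nonsingular (x i) (y i)}
  (hP : ∀ i, frobConj P i = .some (x i) (y i) (hns i))

include hP

lemma frobeniusAlgHom_coord (hK : Module.finrank F K = 3) (i : Fin 3) :
    FiniteField.frobeniusAlgHom F K (x i) = x (i + 1) ∧
      FiniteField.frobeniusAlgHom F K (y i) = y (i + 1) := by
  have h := frob_frobConj hK P i
  rw [hP, hP] at h
  exact (Point.some.injEq ..).mp h

lemma isConjLine_iff {α₁ α₀ : F} : IsConjLine P α₁ α₀ ↔ IsLineSection ((curve A B).baseChange K)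
    (algebraMap F K α₁) (algebraMap F K α₀) x y := by
  have hmap : (cubic A B - (C α₁ * X + C α₀) ^ 2).map (algebraMap F K) =
      cubic (algebraMap F K A) (algebraMap F K B) -
        (C (algebraMap F K α₁) * X + C (algebraMap F K α₀)) ^ 2 := by
    simp [cubic]
  constructor
  · rintro ⟨x', y', hns', hP', hy, hprod⟩
    have hxy i : x' i = x i ∧ y' i = y i :=
      (Point.some.injEq ..).mp ((hP' i).symm.trans (hP i))
    obtain rfl : x' = x := funext fun i ↦ (hxy i).1
    obtain rfl : y' = y := funext fun i ↦ (hxy i).2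
    exact ⟨hy, esymm₃_eq_lineEsymm_iff.mpr (hmap.symm.trans hprod)⟩
  · exact fun h ↦ ⟨x, y, hns, hP, h.y_eq, hmap.trans (esymm₃_eq_lineEsymm_iff.mp h.esymm₃_eq)⟩

lemma exists_isConjLine (hK : Module.finrank F K = 3) (hT : P ∈ T₃ K A B) :
    ∃ α₁ α₀ : F, IsConjLine P α₁ α₀ := by
  rw [mem_T₃_iff, Finset.sum_congr rfl fun i _ ↦ hP i] at hT
  obtain ⟨l, m, h⟩ := exists_isLineSection hns hT
  have hcurve : ((curve A B).baseChange K).map (FiniteField.frobeniusAlgHom F K : K →+* K) =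
      (curve A B).baseChange K := WeierstrassCurve.map_baseChange _ _
  have hx : (FiniteField.frobeniusAlgHom F K ∘ x) ∘ Equiv.subRight 1 = x :=
    funext fun i ↦ by simp [(frobeniusAlgHom_coord hP hK _).1]
  have hy : (FiniteField.frobeniusAlgHom F K ∘ y) ∘ Equiv.subRight 1 = y :=
    funext fun i ↦ by simp [(frobeniusAlgHom_coord hP hK _).2]
  have hfrob := (h.map (FiniteField.frobeniusAlgHom F K : K →+* K)).comp_perm (Equiv.subRight 1)
  rw [hcurve, RingHom.coe_coe, hx, hy] at hfrob
  obtain ⟨hl, hm⟩ := h.unique hns hfrob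
  obtain ⟨α₁, rfl⟩ := mem_range_algebraMap_of_frobeniusAlgHom_eq hl.symm
  obtain ⟨α₀, rfl⟩ := mem_range_algebraMap_of_frobeniusAlgHom_eq hm.symm
  exact ⟨α₁, α₀, (isConjLine_iff hP).mpr h⟩

lemma isConjLine_of_hasDivisor (hK : Module.finrank F K = 3) (hT : P ∈ T₃ K A B) {γ β₁ β₀ : F}
    (h : HasDivisor (lineFun ((curve A B).baseChange K) (algebraMap F K γ) (algebraMap F K β₁)
      (algebraMap F K β₀)) (∑ i, {frobConj P i})) :
    γ ≠ 0 ∧ IsConjLine P (β₁ / γ) (β₀ / γ) := by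
  obtain ⟨α₁, α₀, hα⟩ := exists_isConjLine hP hK hT
  simp only [hP] at h
  obtain ⟨hγ, h₁, h₀⟩ := h.lineFun_eq (((isConjLine_iff hP).mp hα).hasDivisor hns)
  rw [← map_div₀, (algebraMap F K).injective.eq_iff] at h₁ h₀
  rw [h₁, h₀]
  exact ⟨fun h0 ↦ hγ (by rw [h0, map_zero]), hα⟩

end Coordinates

lemma IsConjLine.unique {P : Points K A B} {α₁ α₀ β₁ β₀ : F} (hα : IsConjLine P α₁ α₀)
    (hβ : IsConjLine P β₁ β₀) : α₁ = β₁ ∧ α₀ = β₀ := by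
  have ⟨x, y, hns, hP, _⟩ := hα
  exact (((isConjLine_iff hP).mp hα).unique hns ((isConjLine_iff hP).mp hβ)).imp
    (fun h ↦ (algebraMap F K).injective h) fun h ↦ (algebraMap F K).injective h

lemma existsUnique_isConjLine (hK : Module.finrank F K = 3) {P : Points K A B}
    (hT : P ∈ T₃ K A B) (hP : P ≠ 0) : ∃! α : F × F, IsConjLine P α.1 α.2 := by
  obtain ⟨x, y, hns, hxy⟩ := exists_frobConj_eq_some hP
  obtain ⟨α₁, α₀, hα⟩ := exists_isConjLine hxy hK hT
  exact ⟨(α₁, α₀), hα, fun β hβ ↦ Prod.ext_iff.mpr (hβ.unique hα)⟩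

lemma IsConjLine.two_nsmul (hK : Module.finrank F K = 3) {P : Points K A B} {α₁ α₀ : F}
    (hα : IsConjLine P α₁ α₀) (hT : P ∈ T₃ K A B) (h2P : 2 • P ≠ 0) :
    c A B α₁ α₀ ≠ 0 ∧
      IsConjLine (2 • P) (u₁ A B α₁ α₀ / c A B α₁ α₀) (u₀ A B α₁ α₀ / c A B α₁ α₀) := by
  have ⟨x, y, hns, hP, _⟩ := hα
  obtain ⟨x', y', hns', hP'⟩ := exists_frobConj_eq_some h2P
  refine isConjLine_of_hasDivisor hP' hK (AddSubgroup.nsmul_mem _ hT 2) ?_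
  simp only [frobConj_nsmul, map_c, map_u₁, map_u₀]
  exact ((isConjLine_iff hP).mp hα).hasDivisor_two_nsmul hP

lemma IsConjLine.three_nsmul (hK : Module.finrank F K = 3) (h3 : (3 : K) ≠ 0) {P : Points K A B}
    {α₁ α₀ : F} (hα : IsConjLine P α₁ α₀) (hT : P ∈ T₃ K A B) (h3P : 3 • P ≠ 0) :
    d A B α₁ α₀ ≠ 0 ∧
      IsConjLine (3 • P) (v₁ A B α₁ α₀ / d A B α₁ α₀) (v₀ A B α₁ α₀ / d A B α₁ α₀) := by
  have ⟨x, y, hns, hP, _⟩ := hα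
  obtain ⟨x', y', hns', hP'⟩ := exists_frobConj_eq_some h3P
  refine isConjLine_of_hasDivisor hP' hK (AddSubgroup.nsmul_mem _ hT 3) ?_
  simp only [frobConj_nsmul, map_d, map_v₁, map_v₀]
  exact ((isConjLine_iff hP).mp hα).hasDivisor_three_nsmul h3 hP

end Frobenius

lemma linePoly_scale {k : Type*} [Field k] {t γ β₁ β₀ : k} (hγ : γ ≠ 0) :
    C (C t) * linePoly γ β₁ β₀ = C (C (t * γ)) * linePoly 1 (β₁ / γ) (β₀ / γ) := by
  have hC (a : k) : (C (C a) : k[X][Y]) = C (C γ) * C (C (a / γ)) := by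
    rw [← C_mul, ← C_mul, mul_div_cancel₀ _ hγ]
  simp only [linePoly, C_mul, C_add]
  rw [hC β₁, hC β₀, C_1, C_1]
  ring

lemma three_ne_zero_of_ringChar_ne {F : Type*} [Field F] (h : ringChar F ≠ 3) (R : Type*)
    [CommRing R] [Nontrivial R] [Algebra F R] : (3 : R) ≠ 0 := fun h0 ↦
  ((Nat.dvd_prime Nat.prime_three).mp ((ringChar.spec R 3).mp (mod_cast h0))).elim
    CharP.ringChar_ne_one fun hR ↦ h ((Algebra.ringChar_eq F R).trans hR)

end TraceZero

end

open TraceZero in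
theorem mainTheorem7_general {F : Type u} [Field F] [Fintype F] (hF3 : ringChar F ≠ 3)
    {K : Type v} [Field K] [DecidableEq K] [Algebra F K] (hK : Module.finrank F K = 3)
    (A B : F) :
    (∀ (k : Type w) [Field k] [Algebra F k] (α₁ α₀ : k),
      c (algebraMap F k A) (algebraMap F k B) α₁ α₀ ≠ 0 →
        (∃! L : k[X][Y], IsProcL (algebraMap F k A) (algebraMap F k B) α₁ α₀ L) ∧
        ∀ L : k[X][Y], IsProcL (algebraMap F k A) (algebraMap F k B) α₁ α₀ L →
          ∃ t : k, t ≠ 0 ∧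
            recovered (algebraMap F k A) (algebraMap F k B) α₁ α₀ L =
              toFun (algebraMap F k A) (algebraMap F k B)
                (C (C t) * linePoly
                  (d (algebraMap F k A) (algebraMap F k B) α₁ α₀)
                  (v₁ (algebraMap F k A) (algebraMap F k B) α₁ α₀)
                  (v₀ (algebraMap F k A) (algebraMap F k B) α₁ α₀))) ∧
    ∀ P ∈ T₃ K A B, P ≠ 0 →
      (∃! α : F × F, IsConjLine P α.1 α.2) ∧
      ∀ α₁ α₀ : F, IsConjLine P α₁ α₀ → 3 • P ≠ 0 →
        (d A B α₁ α₀ ≠ 0 ∧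
          IsConjLine (3 • P)
            (v₁ A B α₁ α₀ / d A B α₁ α₀)
            (v₀ A B α₁ α₀ / d A B α₁ α₀)) ∧
        (2 • P ≠ 0 →
          c A B α₁ α₀ ≠ 0 ∧
          (∃! L : F[X][Y], IsProcL A B α₁ α₀ L) ∧
          ∀ L : F[X][Y], IsProcL A B α₁ α₀ L →
            ∀ γ₁ γ₀ : F, IsConjLine (3 • P) γ₁ γ₀ →
              ∃ t : F, t ≠ 0 ∧
                recovered A B α₁ α₀ L =
                  toFun A B (C (C t) * linePoly 1 γ₁ γ₀)) := by
  refine ⟨fun k _ _ α₁ α₀ ↦ procedure_correct (three_ne_zero_of_ringChar_ne hF3 k),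
    fun P hT hP ↦ ⟨existsUnique_isConjLine hK hT hP, fun α₁ α₀ hα h3P ↦ ?_⟩⟩
  obtain ⟨hd, h3α⟩ := hα.three_nsmul hK (three_ne_zero_of_ringChar_ne hF3 K) hT h3P
  refine ⟨⟨hd, h3α⟩, fun h2P ↦ ?_⟩
  have hc := (hα.two_nsmul hK hT h2P).1
  obtain ⟨hL, hrec⟩ := procedure_correct (three_ne_zero_of_ringChar_ne hF3 F) hc
  refine ⟨hc, hL, fun L hL γ₁ γ₀ hγ ↦ ?_⟩
  obtain ⟨t, ht, e⟩ := hrec L hL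
  obtain ⟨rfl, rfl⟩ := hγ.unique h3α
  exact ⟨t * d A B α₁ α₀, mul_ne_zero ht hd, by rw [e, linePoly_scale hd]⟩

theorem mainTheorem7 {F : Type u} [Field F] [Fintype F]
    (hF2 : ringChar F ≠ 2) (hF3 : ringChar F ≠ 3)
    {K : Type v} [Field K] [DecidableEq K] [Algebra F K] (hK : Module.finrank F K = 3)
    (A B : F) (hE : (TraceZero.cubic A B).Separable) :
    -- The procedure, run on `y - (α₁ x + α₀)` with `α₁, α₀` in an extension field of `F`, in
    -- particular with indeterminates `α₁, α₀`, yields the tripling formulas.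
    (∀ (k : Type u) [Field k] [Algebra F k] (α₁ α₀ : k),
      TraceZero.c (algebraMap F k A) (algebraMap F k B) α₁ α₀ ≠ 0 →
        (∃! L : k[X][Y], TraceZero.IsProcL (algebraMap F k A) (algebraMap F k B) α₁ α₀ L) ∧
        ∀ L : k[X][Y], TraceZero.IsProcL (algebraMap F k A) (algebraMap F k B) α₁ α₀ L →
          ∃ t : k, t ≠ 0 ∧
            TraceZero.recovered (algebraMap F k A) (algebraMap F k B) α₁ α₀ L =
              TraceZero.toFun (algebraMap F k A) (algebraMap F k B)
                (C (C t) * TraceZero.linePoly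
                  (TraceZero.d (algebraMap F k A) (algebraMap F k B) α₁ α₀)
                  (TraceZero.v₁ (algebraMap F k A) (algebraMap F k B) α₁ α₀)
                  (TraceZero.v₀ (algebraMap F k A) (algebraMap F k B) α₁ α₀))) ∧
    ∀ P ∈ TraceZero.T₃ K A B, P ≠ 0 →
      -- The line `h_P` exists and is unique.
      (∃! α : F × F, TraceZero.IsConjLine P α.1 α.2) ∧
      ∀ α₁ α₀ : F, TraceZero.IsConjLine P α₁ α₀ → 3 • P ≠ 0 →
        -- The tripling formulas give `h_{3P}`, up to a nonzero constant.
        (TraceZero.d A B α₁ α₀ ≠ 0 ∧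
          TraceZero.IsConjLine (3 • P)
            (TraceZero.v₁ A B α₁ α₀ / TraceZero.d A B α₁ α₀)
            (TraceZero.v₀ A B α₁ α₀ / TraceZero.d A B α₁ α₀)) ∧
        -- The procedure, run on `h_P`, is well defined and recovers `h_{3P}`, up to a nonzero
        -- constant.
        (2 • P ≠ 0 →
          TraceZero.c A B α₁ α₀ ≠ 0 ∧
          (∃! L : F[X][Y], TraceZero.IsProcL A B α₁ α₀ L) ∧
          ∀ L : F[X][Y], TraceZero.IsProcL A B α₁ α₀ L →
            ∀ γ₁ γ₀ : F, TraceZero.IsConjLine (3 • P) γ₁ γ₀ →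
              ∃ t : F, t ≠ 0 ∧
                TraceZero.recovered A B α₁ α₀ L =
                  TraceZero.toFun A B (C (C t) * TraceZero.linePoly 1 γ₁ γ₀)) :=
  mainTheorem7_general hF3 hK A B
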